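/- Let $k$ be an algebraically closed field of characteristic $p>0$. For $f\in k[x_1,\dots,x_N]$ let $$\operatorname{fpt}(f)=\sup\{\,M/p^e \mid M,e\ge 0,\ f^M\notin\langle x_1^{p^e},\dots,x_N^{p^e}\rangle\,\}.$$ An *extremal singularity* of degree $d$ is a reduced form $f$ of degree $d>2$ with $\operatorname{fpt}(f)=\frac1{d-1}$ (the minimal value possible for a reduced form of degree $d$). Two forms in $N$ variables are *isomorphic* if they differ by an invertible linear change of coordinates. The *embedding dimension* of a form is the least number of variables in which it can be written after a linear change of coordinates. The form has an *isolated singularity* if the origin is an isolated point of the singular locus of the hypersurface $f=0$ in $\mathbb A^N$. The form has *full rank* if $f=\sum_{i,j}a_{ij}x_i^{q}x_j$ with $q=p^e$, $e\ge1$, and $(a_{ij})$ an invertible $N\times N$ matrix. 1. For all $N$, $n$ and $d$, the extremal singularities in $N$ variables of degree $d$ and embedding dimension $n$ fall into finitely many isomorphism classes, and the number of these classes is at most $F_n$, where $F_0=F_1=1$ and $F_{m+1}=F_m+F_{m-1}$. 2. For all $N$ and $D$, the extremal singularities in $N$ variables of degree at most $D$ fall into finitely many isomorphism classes. 3. For an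 extremal singularity $f$ of degree $d$ in $n$ variables, the following are equivalent: (a) $f$ has an isolated singularity; (b) $f$ has full rank; (c) $d=q+1$ with $q=p^e$ for some $e\ge 1$, and $f$ is isomorphic to the diagonal form $x_1^{q+1}+\dots+x_n^{q+1}$. 4. For every $n\ge 2$ and $q=p^e$ with $e\ge 1$, among the extremal singularities in $n$ variables of degree $q+1$ and embedding dimension $n$ there is exactly one isomorphism class with an isolated singularity, and it is the class of $x_1^{q+1}+\dots+x_n^{q+1}$. -/

import Mathlib

noncomputable section

namespace FrobThreshold

open MvPolynomial

variable {k : Type*} [Field k] {n : ℕ}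

/-- The ideal `⟨x₁^q, …, xₙ^q⟩`; for `q` a power of the characteristic it is the Frobenius
power `𝔪^[q]` of the homogeneous maximal ideal. -/
def frobPower (k : Type*) [Field k] (n q : ℕ) : Ideal (MvPolynomial (Fin n) k) :=
  Ideal.span (Set.range fun i : Fin n => (X i : MvPolynomial (Fin n) k) ^ q)

/-- The `F`-pure threshold at the origin, `sup { N / p^e | f^N ∉ 𝔪^[p^e] }`.
The set contains `0` and, if `f(0) = 0`, is bounded above. -/
def fpt (p : ℕ) (f : MvPolynomial (Fin n) k) : ℝ :=
  sSup {t : ℝ | ∃ N e : ℕ, f ^ N ∉ frobPower k n (p ^ e) ∧ t = (N : ℝ) / (p : ℝ) ^ e}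

/-- An extremal singularity of degree `d`: a reduced form of degree `d > 2` whose
`F`-pure threshold equals `1 / (d - 1)`. -/
structure IsExtremal (p d : ℕ) (f : MvPolynomial (Fin n) k) : Prop where
  two_lt : 2 < d
  homogeneous : f.IsHomogeneous d
  reduced : Squarefree f
  fpt_eq : fpt p f = 1 / ((d : ℝ) - 1)

/-- The linear substitution `x_i ↦ ∑ j, A i j * x_j`. -/
def linSubst (A : Matrix (Fin n) (Fin n) k) :
    MvPolynomial (Fin n) k →ₐ[k] MvPolynomial (Fin n) k :=
  aeval fun i => ∑ j, C (A i j) * X j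

theorem linSubst_one (f : MvPolynomial (Fin n) k) : linSubst 1 f = f := by
  have h : linSubst (1 : Matrix (Fin n) (Fin n) k) = AlgHom.id k _ := by
    ext1 i
    simp [linSubst, Matrix.one_apply]
  rw [h]
  rfl

theorem linSubst_linSubst (A B : Matrix (Fin n) (Fin n) k) (f : MvPolynomial (Fin n) k) :
    linSubst A (linSubst B f) = linSubst (B * A) f := by
  have h : (linSubst A).comp (linSubst B) = linSubst (B * A) := by
    ext1 i
    simp only [linSubst, AlgHom.comp_apply, aeval_X, map_sum, map_mul, algHom_C,
      algebraMap_eq, Matrix.mul_apply, Finset.sum_mul, Finset.mul_sum]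
    rw [Finset.sum_comm]
    simp only [mul_assoc]
  rw [← h]
  rfl

/-- Two polynomials are isomorphic if they differ by an invertible linear change of
coordinates. -/
def isoSetoid (k : Type*) [Field k] (n : ℕ) : Setoid (MvPolynomial (Fin n) k) where
  r f g := ∃ A : Matrix.GeneralLinearGroup (Fin n) k, linSubst A.val f = g
  iseqv :=
    { refl := fun f => ⟨1, by simpa using linSubst_one f⟩
      symm := by
        rintro f g ⟨A, rfl⟩
        refine ⟨A⁻¹, ?_⟩
        rw [linSubst_linSubst, ← Units.val_mul, mul_inv_cancel]
        simpa using linSubst_one f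
      trans := by
        rintro f g h ⟨A, rfl⟩ ⟨B, rfl⟩
        exact ⟨A * B, by rw [linSubst_linSubst, Units.val_mul]⟩ }

/-- The isomorphism class of a polynomial. -/
def isoClass (f : MvPolynomial (Fin n) k) : Quotient (isoSetoid k n) :=
  Quotient.mk (isoSetoid k n) f

/-- The least number of variables occurring in `f` after a linear change of coordinates.
A form in `n` variables is non-degenerate iff this number is `n`. -/
def embDim (f : MvPolynomial (Fin n) k) : ℕ :=
  sInf (Set.range fun A : Matrix.GeneralLinearGroup (Fin n) k => (linSubst A.val f).vars.card)

/-- The singular points (over `k`) of the affine hypersurface `f = 0`. -/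
def singularLocus (f : MvPolynomial (Fin n) k) : Set (Fin n → k) :=
  {a | eval a f = 0 ∧ ∀ i, eval a (pderiv i f) = 0}

/-- The hypersurface `f = 0` has an isolated singularity at the origin: the origin is
singular, and it is the only singular point in some Zariski open neighbourhood `h ≠ 0`. -/
def HasIsolatedSingularity (f : MvPolynomial (Fin n) k) : Prop :=
  (0 : Fin n → k) ∈ singularLocus f ∧
    ∃ h : MvPolynomial (Fin n) k, eval 0 h ≠ 0 ∧
      ∀ a ∈ singularLocus f, eval a h ≠ 0 → a = 0

/-- The Frobenius form `∑ i j, A i j * x_i^q * x_j` represented by the matrix `A`. -/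
def frobForm (q : ℕ) (A : Matrix (Fin n) (Fin n) k) : MvPolynomial (Fin n) k :=
  ∑ i, ∑ j, C (A i j) * X i ^ q * X j

/-- `f` is a Frobenius form with `q = p^e`, `e ≥ 1`, whose representing matrix has full rank. -/
def IsFullRank (p : ℕ) (f : MvPolynomial (Fin n) k) : Prop :=
  ∃ (e : ℕ) (A : Matrix (Fin n) (Fin n) k), 1 ≤ e ∧ f = frobForm (p ^ e) A ∧ A.rank = n

/-- The diagonal form `x₁^d + ⋯ + xₙ^d`. -/
def diagForm (k : Type*) [Field k] (n d : ℕ) : MvPolynomial (Fin n) k :=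
  ∑ i, X i ^ d

end FrobThreshold

end

/-! A form `f` of degree `d` is extremal exactly when its `F`-pure threshold is as small as a
reduced form allows, and the proof begins by showing that such forms are Frobenius forms
`∑ aᵢⱼ xᵢ^q xⱼ` with `d = q + 1` (`IsExtremal.exists_eq_frobForm`). Let `μ e` be the least `N` with
`f ^ N ∈ 𝔪^[p ^ e]`. If `p ∤ μ e`, differentiating `f ^ μ e` shows that `f ^ (μ e - 1)` multiplies
the Jacobian ideal of `f` into `𝔪^[p ^ e]`. Since `f` is reduced, its singular locus has
codimension at least `2`, so modulo `𝔪^[p ^ e]` the Jacobian ideal contains all forms of degree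
above `(n - 2) p ^ e + c`; comparison with the socle of `k[x] ⧸ 𝔪^[p ^ e]` gives
`2 p ^ e ≤ μ e * d + c'` (`exists_two_mul_le`). The threshold `1 / (d - 1)` gives
`(μ e - 1) (d - 1) ≤ p ^ e`, and for large `e` both cannot hold as `d > 2`. So `p ∣ μ e` for large
`e`, the quotients `μ e / p ^ e` are eventually constant, equal to `1 / (d - 1)`, and flatness of
Frobenius yields `d - 1 = q` and `f ∈ 𝔪^[q]`.

A linear substitution `g` acts on Frobenius forms by the twisted congruence `A ↦ σ(g)ᵀ A g` with
`σ x = x ^ q` (`linSubst_frobForm`). An invertible `A` is congruent to `1`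
(`congruent_one_of_isUnit_det`): the vectors `v` with `v = A⁻¹ σ(A)ᵀ σ²(v)` span the space by
Lang's theorem for semilinear maps (`span_fixed_eq_top`), on them the form is Hermitian, and an
orthonormal basis of such vectors exists. In general, let the right kernel of `A` have dimension
`s + u`, where `u` is the dimension of its intersection with the left kernel, the radical. Then `A`
is congruent to a block form (`exists_congruent_blockForm`) whose class depends only on `s`, `u`
and the class of a matrix of size `n - u - 2 s` and corank at most `s` (`congruent_blockForm`). By
induction the classes of matrices of size `n` and corank at most `t` are no more than the
partitions of integers up to `n` into parts of size at most `t` (`exists_representatives`), and the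
resulting count for a fixed radical is bounded by a Fibonacci number (`sum_partitionCount_le_fib`).

The embedding dimension of a Frobenius form is the codimension of the radical
(`embDim_frobForm_add_finrank_radical`), and its singular locus is given by the equations
`∑ᵢ aᵢⱼ xᵢ^q = 0`, so it is the origin iff `A` is invertible
(`hasIsolatedSingularity_frobForm_iff`). That the diagonal form is itself extremal is seen from the
middle binomial coefficients of `(x₀^(q+1) + x₁^(q+1)) ^ (p ^ b - 1)`, which are prime to `p`
(`isExtremal_diagForm`). -/

noncomputable section

namespace FrobThreshold

open MvPolynomial

variable {k : Type*} [Field k] {n : ℕ}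

/-! ### Frobenius powers of the maximal ideal -/

theorem mem_frobPower_iff {q : ℕ} {f : MvPolynomial (Fin n) k} :
    f ∈ frobPower k n q ↔ ∀ m ∈ f.support, ∃ i, q ≤ m i := by
  have h : frobPower k n q =
      Ideal.span ((fun s => monomial s (1 : k)) ''
        Set.range fun i : Fin n => Finsupp.single i q) := by
    rw [frobPower, ← Set.range_comp]
    congr 2
    funext i
    simp [X_pow_eq_monomial]
  rw [h, mem_ideal_span_monomial_image]
  simp

/-- Flatness of Frobenius, in the only form needed here: `𝔪^[pq]` contracts to `𝔪^[q]`. -/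
theorem pow_char_mem_frobPower_iff {p : ℕ} [Fact p.Prime] [CharP k p] {q : ℕ}
    {f : MvPolynomial (Fin n) k} : f ^ p ∈ frobPower k n (p * q) ↔ f ∈ frobPower k n q := by
  have hp : 0 < p := (Fact.out : p.Prime).pos
  classical
  rw [mem_frobPower_iff, mem_frobPower_iff, ← map_frobenius_expand p,
    support_map_of_injective _ (frobenius_inj k p), support_expand _ hp.ne']
  simp [Nat.mul_le_mul_left_iff hp]

theorem pow_char_pow_mem_frobPower_iff {p : ℕ} [Fact p.Prime] [CharP k p] {q : ℕ} (e : ℕ)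
    {f : MvPolynomial (Fin n) k} :
    f ^ p ^ e ∈ frobPower k n (p ^ e * q) ↔ f ∈ frobPower k n q := by
  induction e with
  | zero => simp
  | succ e ih =>
    rw [pow_succ, pow_mul, mul_comm (p ^ e) p, mul_assoc, pow_char_mem_frobPower_iff, ih]

theorem isHomogeneous_linSubst {d : ℕ} {f : MvPolynomial (Fin n) k} (hf : f.IsHomogeneous d)
    (A : Matrix (Fin n) (Fin n) k) : (linSubst A f).IsHomogeneous d := by
  have := hf.aeval (fun i => ∑ j, C (A i j) * X j)
    (n := 1) fun i => IsHomogeneous.sum _ _ _ fun j _ => isHomogeneous_C_mul_X _ _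
  simpa [linSubst] using this

theorem linSubst_mem_frobPower {p : ℕ} [Fact p.Prime] [CharP k p] {e : ℕ}
    {f : MvPolynomial (Fin n) k} (hf : f ∈ frobPower k n (p ^ e)) (A : Matrix (Fin n) (Fin n) k) :
    linSubst A f ∈ frobPower k n (p ^ e) := by
  have : Ideal.map (linSubst A) (frobPower k n (p ^ e)) ≤ frobPower k n (p ^ e) := by
    rw [frobPower, Ideal.map_span, Ideal.span_le]
    rintro _ ⟨_, ⟨i, rfl⟩, rfl⟩
    simp only [map_pow, linSubst, aeval_X, SetLike.mem_coe, sum_pow_char_pow, mul_pow]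
    exact Ideal.sum_mem _ fun j _ => Ideal.mul_mem_left _ _ (Ideal.subset_span ⟨j, rfl⟩)
  exact this (Ideal.mem_map_of_mem _ hf)

/-- The substitution attached to an invertible matrix, as an algebra automorphism. -/
def linSubstEquiv (A : Matrix.GeneralLinearGroup (Fin n) k) :
    MvPolynomial (Fin n) k ≃ₐ[k] MvPolynomial (Fin n) k :=
  AlgEquiv.ofAlgHom (linSubst A.val) (linSubst A⁻¹.val)
    (AlgHom.ext fun f => by
      simp [linSubst_linSubst, linSubst_one])
    (AlgHom.ext fun f => by
      simp [linSubst_linSubst, linSubst_one])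

@[simp] theorem linSubstEquiv_apply (A : Matrix.GeneralLinearGroup (Fin n) k)
    (f : MvPolynomial (Fin n) k) : linSubstEquiv A f = linSubst A.val f := rfl

theorem linSubst_mem_frobPower_iff {p : ℕ} [Fact p.Prime] [CharP k p] {e : ℕ}
    {f : MvPolynomial (Fin n) k} (A : Matrix.GeneralLinearGroup (Fin n) k) :
    linSubst A.val f ∈ frobPower k n (p ^ e) ↔ f ∈ frobPower k n (p ^ e) := by
  refine ⟨fun h => ?_, fun h => linSubst_mem_frobPower h _⟩
  have := linSubst_mem_frobPower h A⁻¹.val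
  rwa [linSubst_linSubst, ← Units.val_mul, mul_inv_cancel, Units.val_one, linSubst_one] at this

theorem eval_linSubst (A : Matrix (Fin n) (Fin n) k) (f : MvPolynomial (Fin n) k)
    (v : Fin n → k) : eval v (linSubst A f) = eval (A.mulVec v) f := by
  have : (aeval v).comp (linSubst A) = aeval (A.mulVec v) := by
    ext i
    simp [linSubst, Matrix.mulVec, dotProduct]
  simpa [aeval_eq_eval] using congr($this f)

/-- The generators `xⱼ ^ p ^ e` of `𝔪^[p ^ e]` are constants for `∂ᵢ`. -/
theorem pderiv_mem_frobPower {p : ℕ} [Fact p.Prime] [CharP k p] {e : ℕ} (he : e ≠ 0)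
    {f : MvPolynomial (Fin n) k} (hf : f ∈ frobPower k n (p ^ e)) (i : Fin n) :
    pderiv i f ∈ frobPower k n (p ^ e) := by
  rw [frobPower] at hf
  obtain ⟨c, rfl⟩ := Ideal.mem_span_range_iff_exists_fun.1 hf
  rw [map_sum]
  refine Ideal.sum_mem _ fun j _ => ?_
  have : pderiv i ((X j : MvPolynomial (Fin n) k) ^ p ^ e) = 0 := by
    rw [pderiv_pow]
    simp [he]
  rw [pderiv_mul, this, mul_zero, add_zero]
  exact Ideal.mul_mem_left _ _ (Ideal.subset_span ⟨j, rfl⟩)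

/-! ### Graded arguments -/

theorem homogeneousComponent_add_mul {a l : MvPolynomial (Fin n) k} {e : ℕ}
    (hl : l.IsHomogeneous e) (D : ℕ) :
    homogeneousComponent (D + e) (a * l) = homogeneousComponent D a * l := by
  induction a using MvPolynomial.induction_on' with
  | monomial m c =>
    have h := isHomogeneous_monomial (σ := Fin n) (R := k) c (rfl : m.degree = m.degree)
    rw [homogeneousComponent_of_mem h, homogeneousComponent_of_mem (h.mul hl)]
    by_cases hD : D = m.degree <;> simp [hD]
  | add p q hp hq => rw [add_mul, map_add, hp, hq, map_add, add_mul]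

theorem homogeneousComponent_mem_span {S : Set (MvPolynomial (Fin n) k)}
    (hS : ∀ g ∈ S, ∃ D, g.IsHomogeneous D) {f : MvPolynomial (Fin n) k} (hf : f ∈ Ideal.span S)
    (D : ℕ) : homogeneousComponent D f ∈ Ideal.span S := by
  let := MvPolynomial.gradedAlgebra (σ := Fin n) (R := k)
  refine homogeneousComponent_mem_of_mem (Ideal.homogeneous_span _ _ ?_) hf D
  rintro g hg
  obtain ⟨D, hD⟩ := hS g hg
  exact ⟨D, hD⟩

/-- Let `L` be generated by linear forms. If `J + L` contains all forms of degree at least `c`, then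
expanding the coefficients of the generators of `L` again and again puts every form of degree at
least `c + b` into `J + L ^ (b + 1)`. -/
theorem mem_sup_pow_of_isHomogeneous {ι : Type*} [Fintype ι] (J : Ideal (MvPolynomial (Fin n) k))
    (hJ : ∀ f ∈ J, ∀ D, homogeneousComponent D f ∈ J) (l : ι → MvPolynomial (Fin n) k)
    (hl : ∀ i, (l i).IsHomogeneous 1) (c : ℕ)
    (hc : ∀ D ≥ c, ∀ F : MvPolynomial (Fin n) k, F.IsHomogeneous D →
      F ∈ J ⊔ Ideal.span (Set.range l)) (b : ℕ) :
    ∀ D ≥ c + b, ∀ F : MvPolynomial (Fin n) k, F.IsHomogeneous D →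
      F ∈ J ⊔ Ideal.span (Set.range l) ^ (b + 1) := by
  induction b with
  | zero => simpa using hc
  | succ b ih =>
    intro D hD F hF
    obtain ⟨j, hj, x, hx, rfl⟩ := Submodule.mem_sup.1 (hc D (by lia) F hF)
    obtain ⟨a, rfl⟩ := Ideal.mem_span_range_iff_exists_fun.1 hx
    rw [← homogeneousComponent_eq_self hF, map_add, map_sum]
    refine Ideal.add_mem _ (Ideal.mem_sup_left (hJ _ hj _)) (Ideal.sum_mem _ fun i _ => ?_)
    obtain ⟨D, rfl⟩ : ∃ D', D = D' + 1 := ⟨D - 1, by lia⟩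
    rw [homogeneousComponent_add_mul (hl i)]
    have h1 := ih D (by lia) _ (homogeneousComponent_isHomogeneous D (a i))
    obtain ⟨j', hj', y, hy, h2⟩ := Submodule.mem_sup.1 h1
    rw [← h2, add_mul]
    refine Ideal.add_mem _ (Ideal.mem_sup_left (Ideal.mul_mem_right _ _ hj'))
      (Ideal.mem_sup_right ?_)
    rw [pow_succ]
    exact Ideal.mul_mem_mul hy (Ideal.subset_span ⟨i, rfl⟩)

/-- Pigeonhole: in a product of more than `r (p ^ e - 1)` of the `r` given linear forms some form
occurs at least `p ^ e` times. -/
theorem span_pow_le_frobPower {p : ℕ} [Fact p.Prime] [CharP k p] {e r : ℕ}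
    (l : Fin r → MvPolynomial (Fin n) k) (hl : ∀ i, ∃ v : Fin n → k, l i = ∑ j, C (v j) * X j) :
    Ideal.span (Set.range l) ^ (r * (p ^ e - 1) + 1) ≤ frobPower k n (p ^ e) := by
  have hq : ∀ i, l i ^ p ^ e ∈ frobPower k n (p ^ e) := by
    intro i
    obtain ⟨v, hv⟩ := hl i
    rw [hv, sum_pow_char_pow]
    simp_rw [mul_pow]
    exact Ideal.sum_mem _ fun j _ => Ideal.mul_mem_left _ _ (Ideal.subset_span ⟨j, rfl⟩)
  intro x hx
  obtain ⟨g, hg, rfl⟩ := (Ideal.mem_span_pow_iff_exists_isHomogeneous l x).1 hx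
  rw [eval_eq']
  refine Ideal.sum_mem _ fun d hd => Ideal.mul_mem_left _ _ ?_
  have hdeg := hg (mem_support_iff.1 hd)
  obtain ⟨i, hi⟩ : ∃ i, p ^ e ≤ d i := by
    by_contra! h
    have : ∑ i, d i ≤ ∑ _i : Fin r, (p ^ e - 1) := Finset.sum_le_sum fun i _ => by have := h i; lia
    rw [Finsupp.weight_apply, Finsupp.sum_fintype _ _ (by simp)] at hdeg
    simp at hdeg this
    lia
  rw [← Finset.mul_prod_erase _ _ (Finset.mem_univ i)]
  refine Ideal.mul_mem_right _ _ ?_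
  rw [← Nat.sub_add_cancel hi, pow_add]
  exact Ideal.mul_mem_left _ _ (hq i)

/-! ### Singular locus of a reduced form -/

/-- Over a perfect field of characteristic `p`, a polynomial with vanishing partial derivatives is
a `p`-th power. -/
theorem exists_pow_eq_of_pderiv_eq_zero {p : ℕ} [Fact p.Prime] [CharP k p] [PerfectRing k p]
    {f : MvPolynomial (Fin n) k} (hf : ∀ i, pderiv i f = 0) : ∃ g, g ^ p = f := by
  have hp : p.Prime := Fact.out
  have hdvd : ∀ m ∈ f.support, ∀ i, p ∣ m i := by
    intro m hm i
    by_contra h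
    have h0 : m i ≠ 0 := fun h0 => h (by simp [h0])
    have h1 := coeff_pderiv (i := i) f (m - Finsupp.single i 1)
    have h2 : m - Finsupp.single i 1 + Finsupp.single i 1 = m :=
      tsub_add_cancel_of_le (by simpa [Nat.one_le_iff_ne_zero] using h0)
    rw [hf i, h2, coeff_zero] at h1
    have h3 : (((m - Finsupp.single i 1 : Fin n →₀ ℕ) i : ℕ) : k) + 1 = (m i : k) := by
      conv_rhs => rw [← h2]
      simp
    rw [h3] at h1
    rcases mul_eq_zero.1 h1.symm with h4 | h4
    · exact mem_support_iff.1 hm h4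
    · exact h ((CharP.cast_eq_zero_iff k p _).1 h4)
  refine ⟨∑ m ∈ f.support, monomial (m.mapRange (· / p) (by simp))
    ((frobeniusEquiv k p).symm (coeff m f)), ?_⟩
  rw [sum_pow_char]
  conv_rhs => rw [f.as_sum]
  refine Finset.sum_congr rfl fun m hm => ?_
  rw [monomial_pow]
  have hm' : p • m.mapRange (· / p) (by simp) = m := by
    ext i
    simp [Nat.mul_div_cancel' (hdvd m hm i)]
  rw [hm', frobeniusEquiv_symm_pow_p]

/-- An irreducible factor of a squarefree `f` over a perfect field fails to divide some partial
derivative of `f`. -/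
theorem exists_not_dvd_pderiv {p : ℕ} [Fact p.Prime] [CharP k p] [PerfectRing k p]
    {f h : MvPolynomial (Fin n) k} (hf : Squarefree f) (hh : Irreducible h) (hd : h ∣ f) :
    ∃ i, ¬ h ∣ pderiv i f := by
  by_contra! H
  obtain ⟨g, rfl⟩ := hd
  have hg : ¬ h ∣ g := fun ⟨c, hc⟩ => hh.not_isUnit (hf h ⟨c, by rw [hc]; ring⟩)
  have h0 : ∀ i, pderiv i h = 0 := by
    intro i
    by_contra hne
    have h1 : h ∣ g * pderiv i h := by
      have := H i
      rw [pderiv_mul] at this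
      rw [mul_comm g]
      exact (dvd_add_left (dvd_mul_right _ _)).1 this
    have h2 := (hh.prime.dvd_or_dvd h1).resolve_left hg
    obtain ⟨c, hc⟩ := h2
    have hc0 : c ≠ 0 := by rintro rfl; exact hne (by simpa using hc)
    have hle : h.degreeOf i ≤ (pderiv i h).degreeOf i := by
      rw [hc, degreeOf_mul_eq hh.ne_zero hc0]
      exact Nat.le_add_right _ _
    -- Differentiation lowers the degree in `xᵢ`.
    have hlt : (pderiv i h).degreeOf i < h.degreeOf i := by
      obtain ⟨m, hm⟩ := ne_zero_iff.1 hne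
      have hpos : 0 < h.degreeOf i := by
        have hm' := left_ne_zero_of_mul (coeff_pderiv (i := i) h m ▸ hm)
        have := monomial_le_degreeOf i (mem_support_iff.2 hm')
        simp at this
        lia
      rw [degreeOf_lt_iff hpos]
      intro m hm
      have hm' := left_ne_zero_of_mul (coeff_pderiv (i := i) h m ▸ mem_support_iff.1 hm)
      have := monomial_le_degreeOf i (mem_support_iff.2 hm')
      simp at this
      lia
    exact absurd hle (not_le.2 hlt)
  obtain ⟨c, rfl⟩ := exists_pow_eq_of_pderiv_eq_zero (p := p) h0
  exact not_irreducible_pow (Fact.out : p.Prime).ne_one hh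

/-- Elimination: an ideal of `A[X]` containing a primitive polynomial either contains a nonzero
constant or has a common irreducible factor. Over the fraction field of `A` the ideal is
principal, and Gauss's lemma brings its generator back to `A[X]`. -/
theorem exists_C_mem_or_exists_irreducible_dvd {A : Type*} [CommRing A] [IsDomain A]
    [UniqueFactorizationMonoid A] (I : Ideal (Polynomial A)) {P : Polynomial A} (hP : P ∈ I)
    (hprim : P.IsPrimitive) :
    (∃ r : A, r ≠ 0 ∧ Polynomial.C r ∈ I) ∨ ∃ h, Irreducible h ∧ ∀ g ∈ I, h ∣ g := by
  let K := FractionRing A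
  -- Gauss's lemma in Mathlib is stated over a `NormalizedGCDMonoid`.
  let _ := Classical.choice (inferInstance : Nonempty (NormalizedGCDMonoid A))
  let _ : Algebra (Polynomial A) (Polynomial K) := Polynomial.algebra A K
  have hloc : IsLocalization ((nonZeroDivisors A).map Polynomial.C) (Polynomial K) :=
    Polynomial.isLocalization (nonZeroDivisors A) K
  refine or_iff_not_imp_left.2 fun hno => ?_
  have hdisj : Disjoint (((nonZeroDivisors A).map Polynomial.C : Submonoid (Polynomial A)) :
      Set (Polynomial A)) I := by
    rw [Set.disjoint_left]
    rintro _ ⟨r, hr, rfl⟩ hmem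
    exact hno ⟨r, nonZeroDivisors.ne_zero hr, hmem⟩
  have htop := (IsLocalization.map_algebraMap_ne_top_iff_disjoint _ (Polynomial K) I).2 hdisj
  obtain ⟨M, hM, hIM⟩ := Ideal.exists_le_maximal _ htop
  have hmem : ∀ g ∈ I, g.map (algebraMap A K) ∈ M := fun g hg => hIM (Ideal.mem_map_of_mem _ hg)
  obtain ⟨s, hs, u, hu⟩ := UniqueFactorizationMonoid.exists_prime_factors P hprim.ne_zero
  have hprod : s.prod ∈ M.comap (Polynomial.mapRingHom (algebraMap A K)) := by
    have : P * ↑u⁻¹ = s.prod := by rw [← hu]; simp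
    rw [← this]
    exact Ideal.mul_mem_right _ _ (hmem P hP)
  have hMp := hM.isPrime
  obtain ⟨h, hh, hhM⟩ := (Ideal.IsPrime.multiset_prod_mem_iff_exists_mem
    (Ideal.IsPrime.comap _) s).1 hprod
  have hdvd : h ∣ P := (Multiset.dvd_prod hh).trans ⟨u, hu.symm⟩
  have hhp : h.IsPrimitive := Polynomial.isPrimitive_of_dvd hprim hdvd
  have hirr : Irreducible (h.map (algebraMap A K)) :=
    hhp.irreducible_iff_irreducible_map_fraction_map.1 (hs h hh).irreducible
  refine ⟨h, (hs h hh).irreducible, fun g hg =>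
    hhp.dvd_of_fraction_map_dvd_fraction_map (K := K) ?_⟩
  obtain ⟨π, hπ⟩ := (IsPrincipalIdealRing.principal M).principal
  replace hπ : M = Ideal.span {π} := hπ
  have h1 : π ∣ h.map (algebraMap A K) := Ideal.mem_span_singleton.1 (hπ ▸ hhM)
  have h2 : π ∣ g.map (algebraMap A K) := Ideal.mem_span_singleton.1 (hπ ▸ hmem g hg)
  have hπu : ¬ IsUnit π := fun hu => hM.ne_top (hπ.trans (Ideal.span_singleton_eq_top.2 hu))
  exact ((hirr.dvd_iff.1 h1).resolve_left hπu).dvd.trans h2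

/-- The Jacobian ideal `⟨f, ∂₁f, …, ∂ₙf⟩`. -/
def jacobianIdeal (f : MvPolynomial (Fin n) k) : Ideal (MvPolynomial (Fin n) k) :=
  Ideal.span (insert f (Set.range fun i => pderiv i f))

theorem self_mem_jacobianIdeal (f : MvPolynomial (Fin n) k) : f ∈ jacobianIdeal f :=
  Ideal.subset_span (Set.mem_insert _ _)

theorem pderiv_mem_jacobianIdeal (f : MvPolynomial (Fin n) k) (i : Fin n) :
    pderiv i f ∈ jacobianIdeal f :=
  Ideal.subset_span (Set.mem_insert_of_mem _ ⟨i, rfl⟩)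

theorem isHomogeneous_pderiv {d : ℕ} {f : MvPolynomial (Fin n) k} (hf : f.IsHomogeneous d)
    (i : Fin n) : (pderiv i f).IsHomogeneous (d - 1) := by
  intro m hm
  have hm' := left_ne_zero_of_mul (coeff_pderiv (i := i) f m ▸ hm)
  have := hf hm'
  simp only [map_add, Finsupp.weight_single, Pi.one_apply, smul_eq_mul, mul_one] at this
  lia

theorem homogeneousComponent_mem_jacobianIdeal {d : ℕ} {f : MvPolynomial (Fin n) k}
    (hf : f.IsHomogeneous d) {g : MvPolynomial (Fin n) k} (hg : g ∈ jacobianIdeal f) (D : ℕ) :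
    homogeneousComponent D g ∈ jacobianIdeal f := by
  refine homogeneousComponent_mem_span ?_ hg D
  rintro _ (rfl | ⟨i, rfl⟩)
  exacts [⟨d, hf⟩, ⟨d - 1, isHomogeneous_pderiv hf i⟩]

/-- A form at a point of the line through `c`, with values in any algebra. -/
theorem aeval_mul_of_isHomogeneous {S : Type*} [CommRing S] [Algebra k S] {D : ℕ}
    {F : MvPolynomial (Fin n) k} (hF : F.IsHomogeneous D) (c : Fin n → k) (y : S) :
    aeval (fun j => algebraMap k S (c j) * y) F = algebraMap k S (eval c F) * y ^ D := by
  rw [aeval_def, eval₂_eq', eval_eq', map_sum, Finset.sum_mul]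
  refine Finset.sum_congr rfl fun m hm => ?_
  have hD : ∑ j, m j = D := by
    have := hF (mem_support_iff.1 hm)
    rwa [Finsupp.weight_apply, Finsupp.sum_fintype _ _ (by simp), Finset.sum_congr rfl fun j _ =>
      (show m j • (1 : Fin n → ℕ) j = m j by simp)] at this
  simp_rw [mul_pow, Finset.prod_mul_distrib, Finset.prod_pow_eq_pow_sum, hD, map_mul, map_prod,
    map_pow, mul_assoc]

/-- Polynomials respect congruences modulo an ideal. -/
theorem aeval_sub_aeval_mem {S : Type*} [CommRing S] [Algebra k S] (I : Ideal S) {a b : Fin n → S}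
    (hab : ∀ j, a j - b j ∈ I) (F : MvPolynomial (Fin n) k) : aeval a F - aeval b F ∈ I := by
  rw [← Ideal.Quotient.eq]
  have : (Ideal.Quotient.mkₐ k I).comp (aeval a) = (Ideal.Quotient.mkₐ k I).comp (aeval b) := by
    ext j
    simpa using Ideal.Quotient.eq.2 (hab j)
  simpa using congr($this F)

theorem eval_single_of_isHomogeneous {d : ℕ} {f : MvPolynomial (Fin n) k} (hf : f.IsHomogeneous d)
    (i : Fin n) : eval (Pi.single i 1) f = coeff (Finsupp.single i d) f := by
  rw [eval_eq', Finset.sum_eq_single (Finsupp.single i d)]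
  · rw [Finset.prod_eq_one, mul_one]
    intro j _
    by_cases h : j = i
    · subst h; simp
    · simp [Ne.symm h]
  · intro m hm hne
    obtain ⟨j, hj, hmj⟩ : ∃ j, j ≠ i ∧ m j ≠ 0 := by
      by_contra! H
      refine hne ?_
      have hm' := hf (mem_support_iff.1 hm)
      rw [Finsupp.weight_apply, Finsupp.sum_fintype _ _ (by simp),
        Finset.sum_eq_single i (fun j _ hj => by simp [H j hj]) (by simp)] at hm'
      ext j
      by_cases h : j = i
      · subst h; simpa using hm'
      · simp [H j h, Ne.symm h]
    rw [Finset.prod_eq_zero (Finset.mem_univ j) (by simp [hj, hmj]), mul_zero]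
  · intro h
    rw [notMem_support_iff.1 h, zero_mul]

theorem finSuccEquiv_rename_succ (r : MvPolynomial (Fin n) k) :
    finSuccEquiv k n (rename Fin.succ r) = Polynomial.C r := by
  induction r using MvPolynomial.induction_on with
  | C a => simp [finSuccEquiv_apply]
  | add p q hp hq => rw [map_add, map_add, hp, hq, map_add]
  | mul_X p i hp => rw [map_mul, map_mul, hp, rename_X, finSuccEquiv_X_succ, map_mul]

/-- The Jacobian ideal of a reduced form that is monic in `x₀` contains a nonzero form in the
remaining variables: otherwise, by elimination, some irreducible polynomial would divide the form
and all its partial derivatives. -/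
theorem exists_rename_succ_mem_jacobianIdeal {p : ℕ} [Fact p.Prime] [CharP k p] [PerfectRing k p]
    {d : ℕ} {f : MvPolynomial (Fin (n + 1)) k} (hf : f.IsHomogeneous d) (hsq : Squarefree f)
    (h0 : eval (Pi.single 0 1) f ≠ 0) :
    ∃ D, ∃ r : MvPolynomial (Fin n) k, r ≠ 0 ∧ r.IsHomogeneous D ∧
      rename Fin.succ r ∈ jacobianIdeal f := by
  let φ := finSuccEquiv k n
  have hmem : ∀ g, φ g ∈ (jacobianIdeal f).map φ ↔ g ∈ jacobianIdeal f := by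
    intro g
    have := Ideal.mem_map_of_equiv φ (I := jacobianIdeal f) (φ g)
    rw [this]
    simp
  have hprim : (φ f).IsPrimitive := by
    intro r hr
    have h1 := (Polynomial.C_dvd_iff_dvd_coeff _ _).1 hr d
    have h2 := hf.finSuccEquiv_coeff_isHomogeneous d 0 (by simp)
    rw [← homogeneousComponent_eq_self h2, homogeneousComponent_zero] at h1
    refine isUnit_of_dvd_unit h1 (IsUnit.map C (IsUnit.mk0 _ ?_))
    rw [finSuccEquiv_coeff_coeff]
    rw [eval_single_of_isHomogeneous hf] at h0
    convert h0 using 2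
    ext i
    refine Fin.cases ?_ (fun i => ?_) i <;> simp
  rcases exists_C_mem_or_exists_irreducible_dvd ((jacobianIdeal f).map φ)
    ((hmem f).2 (self_mem_jacobianIdeal f)) hprim with ⟨r, hr0, hr⟩ | ⟨h, hirr, hdvd⟩
  · have hr' : rename Fin.succ r ∈ jacobianIdeal f := by
      rw [← hmem]
      convert hr
      exact finSuccEquiv_rename_succ r
    obtain ⟨D, hD⟩ : ∃ D, homogeneousComponent D r ≠ 0 := by
      by_contra! H
      exact hr0 (by rw [← sum_homogeneousComponent r]; simp [H])
    refine ⟨D, _, hD, homogeneousComponent_isHomogeneous D r, ?_⟩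
    rw [rename_homogeneousComponent]
    exact homogeneousComponent_mem_jacobianIdeal hf hr' D
  · exfalso
    have hdvd' : ∀ g ∈ jacobianIdeal f, φ.symm h ∣ g := fun g hg => by
      simpa using map_dvd φ.symm (hdvd _ ((hmem g).2 hg))
    obtain ⟨i, hi⟩ := exists_not_dvd_pderiv (p := p) hsq
      ((MulEquiv.irreducible_iff φ.symm).2 hirr) (hdvd' f (self_mem_jacobianIdeal f))
    exact hi (hdvd' _ (pderiv_mem_jacobianIdeal f i))

/-- The matrix of a linear automorphism of `kⁿ`, as an element of `GLₙ(k)`. -/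
def glOfLinearEquiv (g : (Fin n → k) ≃ₗ[k] (Fin n → k)) : Matrix.GeneralLinearGroup (Fin n) k where
  val := LinearMap.toMatrix' g
  inv := LinearMap.toMatrix' g.symm
  val_inv := by rw [← LinearMap.toMatrix'_comp]; simp
  inv_val := by rw [← LinearMap.toMatrix'_comp]; simp

theorem exists_gl_mulVec_eq {v w : Fin n → k} (hv : v ≠ 0) (hw : w ≠ 0) :
    ∃ A : Matrix.GeneralLinearGroup (Fin n) k, A.val.mulVec v = w := by
  let f := (LinearEquiv.toSpanNonzeroSingleton k (Fin n → k) v hv).symm.trans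
    (LinearEquiv.toSpanNonzeroSingleton k (Fin n → k) w hw)
  obtain ⟨g, hg⟩ := Submodule.exists_linearEquiv_restrict_eq f
  refine ⟨glOfLinearEquiv g, ?_⟩
  have h1 := hg (LinearEquiv.toSpanNonzeroSingleton k (Fin n → k) v hv 1)
  simp only [f, LinearEquiv.trans_apply, LinearEquiv.symm_apply_apply] at h1
  simp only [LinearEquiv.toSpanNonzeroSingleton_apply, one_smul] at h1
  simp [glOfLinearEquiv, ← h1]

theorem mem_span_X_pow_of_isHomogeneous {F : MvPolynomial (Fin n) k} {D : ℕ}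
    (hF : F.IsHomogeneous D) :
    F ∈ Ideal.span (Set.range (X : Fin n → MvPolynomial (Fin n) k)) ^ D := by
  refine (Ideal.mem_span_pow_iff_exists_isHomogeneous _ _).2 ⟨map C F, hF.map C, ?_⟩
  rw [eval_map, eval₂_eta]

theorem eval_mul_of_isHomogeneous {F : MvPolynomial (Fin n) k} {D : ℕ}
    (hF : F.IsHomogeneous D) (c : Fin n → k) (y : k) :
    eval (fun j => c j * y) F = eval c F * y ^ D := by
  simpa [aeval_eq_eval] using aeval_mul_of_isHomogeneous hF c y

/-- For a reduced form monic in `x₀`, the Jacobian ideal together with suitable linear forms, two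
fewer than there are variables, contains every form of large degree: a general plane meets the
singular locus only in the origin. -/
theorem exists_linear_forms {p : ℕ} [Fact p.Prime] [CharP k p] [IsAlgClosed k]
    {d : ℕ} {f : MvPolynomial (Fin (n + 2)) k} (hf : f.IsHomogeneous d) (hsq : Squarefree f)
    (h0 : eval (Pi.single 0 1) f ≠ 0) :
    ∃ l : Fin n → MvPolynomial (Fin (n + 2)) k,
      (∀ i, ∃ v : Fin (n + 2) → k, l i = ∑ j, C (v j) * X j) ∧
      ∃ c, ∀ D ≥ c, ∀ F : MvPolynomial (Fin (n + 2)) k, F.IsHomogeneous D →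
        F ∈ jacobianIdeal f ⊔ Ideal.span (Set.range l) := by
  obtain ⟨D, r, hr0, hr, hrJ⟩ := exists_rename_succ_mem_jacobianIdeal (p := p) hf hsq h0
  -- Multiplying `r` by its first variable gives a point off `r = 0` whose first coordinate is
  -- nonzero, hence may be scaled to `1`.
  obtain ⟨u', hu'⟩ : ∃ u, eval u (r * X 0) ≠ 0 := by
    by_contra! H
    exact mul_ne_zero hr0 (X_ne_zero 0)
      (IsHomogeneous.eq_zero_of_forall_eval_eq_zero (hr.mul (isHomogeneous_X k 0)) H)
  rw [map_mul, eval_X] at hu'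
  have hu0 := right_ne_zero_of_mul hu'
  let u : Fin (n + 1) → k := fun j => u' j * (u' 0)⁻¹
  have hu : eval u r ≠ 0 := by
    rw [eval_mul_of_isHomogeneous hr]
    exact mul_ne_zero (left_ne_zero_of_mul hu') (pow_ne_zero _ (inv_ne_zero hu0))
  have hu1 : u 0 = 1 := mul_inv_cancel₀ hu0
  -- The linear forms cut out the plane spanned by `(1, 0)` and `(0, u)`.
  let l : Fin n → MvPolynomial (Fin (n + 2)) k := fun i => X i.succ.succ - C (u i.succ) * X 1
  refine ⟨l, fun i => ⟨Pi.single i.succ.succ 1 - Pi.single 1 (u i.succ), ?_⟩, ?_⟩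
  · simp [l, sub_mul, Finset.sum_sub_distrib, Pi.single_apply, apply_ite C]
  set I := jacobianIdeal f ⊔ Ideal.span (Set.range l) with hI
  have hl : ∀ j : Fin (n + 1), X j.succ - C (u j) * X 1 ∈ I := by
    intro j
    refine Fin.cases ?_ (fun i => ?_) j
    · simp [hu1]
    · exact Ideal.mem_sup_right (Ideal.subset_span ⟨i, rfl⟩)
  have hX1 : (X 1 : MvPolynomial (Fin (n + 2)) k) ∈ I.radical := by
    refine ⟨D, ?_⟩
    have h1 : rename Fin.succ r - C (eval u r) * X 1 ^ D ∈ I := by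
      have := aeval_sub_aeval_mem I hl r
      rw [show (fun j => C (u j) * X 1) =
        fun j => algebraMap k (MvPolynomial (Fin (n + 2)) k) (u j) * X 1 from rfl,
        aeval_mul_of_isHomogeneous hr u, algebraMap_eq] at this
      rwa [show aeval (fun j => X j.succ) r = rename Fin.succ r by
        rw [← aeval_X_left_apply (rename Fin.succ r), aeval_rename]; rfl] at this
    have h2 := I.sub_mem (Ideal.mem_sup_left hrJ) h1
    rw [sub_sub_cancel] at h2
    have h3 := I.mul_mem_left (C (eval u r)⁻¹) h2
    rwa [← mul_assoc, ← C_mul, inv_mul_cancel₀ hu, C_1, one_mul] at h3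
  have hXs : ∀ j : Fin (n + 1), (X j.succ : MvPolynomial (Fin (n + 2)) k) ∈ I.radical := by
    intro j
    have := I.radical.add_mem (Ideal.le_radical (hl j)) (I.radical.mul_mem_left (C (u j)) hX1)
    simpa using this
  have hX0 : (X 0 : MvPolynomial (Fin (n + 2)) k) ∈ I.radical := by
    rw [← Ideal.radical_idem]
    refine ⟨d, ?_⟩
    have h1 : f - C (eval (Pi.single 0 1) f) * X 0 ^ d ∈ I.radical := by
      have := aeval_sub_aeval_mem I.radical (a := X)
        (b := fun j => algebraMap k _ ((Pi.single 0 1 : Fin (n + 2) → k) j) * X 0) (fun j => ?_) f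
      · rwa [aeval_mul_of_isHomogeneous hf, aeval_X_left_apply] at this
      · refine Fin.cases ?_ (fun i => ?_) j
        · simp
        · simpa using hXs i
    have h2 := I.radical.sub_mem
      (Ideal.le_radical (Ideal.mem_sup_left (self_mem_jacobianIdeal f))) h1
    rw [sub_sub_cancel] at h2
    have h3 := I.radical.mul_mem_left (C (eval (Pi.single 0 1) f)⁻¹) h2
    rwa [← mul_assoc, ← C_mul, inv_mul_cancel₀ h0, C_1, one_mul] at h3
  have hrad : Ideal.span (Set.range (X : Fin (n + 2) → MvPolynomial (Fin (n + 2)) k)) ≤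
      I.radical := by
    rw [Ideal.span_le]
    rintro _ ⟨j, rfl⟩
    exact Fin.cases hX0 hXs j
  obtain ⟨c, hc⟩ := Ideal.exists_pow_le_of_le_radical_of_fg hrad
    (Submodule.fg_span (Set.finite_range _))
  exact ⟨c, fun D hD F hF => hc (Ideal.pow_le_pow_right hD (mem_span_X_pow_of_isHomogeneous hF))⟩

/-- In degrees above a bound of order `(n - 2) Q`, every form lies in `⟨f, ∂₁f, …, ∂ₙf⟩ + 𝔪^[Q]`,
for `f` a reduced form monic in `x₀`. -/
theorem exists_forall_mem_jacobianIdeal_sup_frobPower {p : ℕ} [Fact p.Prime] [CharP k p]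
    [IsAlgClosed k] {d : ℕ} {f : MvPolynomial (Fin (n + 2)) k} (hf : f.IsHomogeneous d)
    (hsq : Squarefree f) (h0 : eval (Pi.single 0 1) f ≠ 0) :
    ∃ c, ∀ e, ∀ D ≥ c + n * (p ^ e - 1), ∀ F : MvPolynomial (Fin (n + 2)) k, F.IsHomogeneous D →
      F ∈ jacobianIdeal f ⊔ frobPower k (n + 2) (p ^ e) := by
  obtain ⟨l, hl, c, hc⟩ := exists_linear_forms (p := p) hf hsq h0
  refine ⟨c, fun e D hD F hF => ?_⟩
  have hl1 : ∀ i, (l i).IsHomogeneous 1 := fun i => by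
    obtain ⟨v, hv⟩ := hl i
    rw [hv]
    exact IsHomogeneous.sum _ _ _ fun j _ => isHomogeneous_C_mul_X _ _
  exact sup_le_sup_left (span_pow_le_frobPower l hl) _
    (mem_sup_pow_of_isHomogeneous _ (fun g hg D => homogeneousComponent_mem_jacobianIdeal hf hg D)
      l hl1 c hc _ D hD F hF)

/-- If `f ^ N ∉ 𝔪^[Q]` while `f ^ (N + 1) ∈ 𝔪^[Q]` and `p ∤ N + 1`, then differentiating shows that
`f ^ N` multiplies the Jacobian ideal into `𝔪^[Q]`. Comparing with the socle degree `n (Q - 1)` of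
`k[x] ⧸ 𝔪^[Q]` bounds `N` from below. -/
theorem exists_two_mul_le {p : ℕ} [Fact p.Prime] [CharP k p]
    [IsAlgClosed k] {d : ℕ} {f : MvPolynomial (Fin (n + 2)) k} (hf : f.IsHomogeneous d)
    (hd : d ≠ 0) (hsq : Squarefree f) :
    ∃ c, ∀ e ≠ 0, ∀ N, f ^ N ∉ frobPower k (n + 2) (p ^ e) →
      f ^ (N + 1) ∈ frobPower k (n + 2) (p ^ e) → ¬ p ∣ N + 1 → 2 * (p ^ e - 1) ≤ N * d + c := by
  obtain ⟨w, hw⟩ : ∃ w, eval w f ≠ 0 := by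
    by_contra! H
    exact hsq.ne_zero (IsHomogeneous.eq_zero_of_forall_eval_eq_zero hf H)
  have hw0 : w ≠ 0 := by
    rintro rfl
    refine hw ?_
    have := eval_mul_of_isHomogeneous hf 0 0
    simpa [hd] using this
  -- After a change of coordinates the form is monic in `x₀`.
  obtain ⟨A, hA⟩ := exists_gl_mulVec_eq (v := Pi.single 0 1) (by simp) hw0
  have hg : (linSubst A.val f).IsHomogeneous d := isHomogeneous_linSubst hf _
  have hgsq : Squarefree (linSubst A.val f) := by
    intro x hx
    have h1 := hsq ((linSubstEquiv A).symm x) (by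
      have := map_dvd (linSubstEquiv A).symm hx
      rwa [map_mul, ← linSubstEquiv_apply, AlgEquiv.symm_apply_apply] at this)
    simpa using h1.map (linSubstEquiv A)
  obtain ⟨c, hc⟩ := exists_forall_mem_jacobianIdeal_sup_frobPower (p := p) hg hgsq
    (by rwa [eval_linSubst, hA])
  refine ⟨c, fun e he N hN hN1 hpN => ?_⟩
  rw [← linSubst_mem_frobPower_iff A, map_pow] at hN hN1
  set g := linSubst A.val f
  by_contra! hlt
  obtain ⟨m, hm, hmQ⟩ : ∃ m ∈ (g ^ N).support, ∀ i, m i < p ^ e := by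
    by_contra! H
    exact hN (mem_frobPower_iff.2 H)
  have hJ : ∀ x ∈ jacobianIdeal g ⊔ frobPower k (n + 2) (p ^ e),
      g ^ N * x ∈ frobPower k (n + 2) (p ^ e) := by
    suffices jacobianIdeal g ⊔ frobPower k (n + 2) (p ^ e) ≤
        Submodule.comap (LinearMap.mulLeft (MvPolynomial (Fin (n + 2)) k) (g ^ N))
          (frobPower k (n + 2) (p ^ e))
      from fun x hx => this hx
    refine sup_le ?_ fun x hx => Ideal.mul_mem_left _ _ hx
    rw [jacobianIdeal]
    refine Ideal.span_le.2 ?_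
    rintro _ (rfl | ⟨i, rfl⟩)
    · simpa [pow_succ] using hN1
    · have h1 := pderiv_mem_frobPower he hN1 i
      rw [pderiv_pow, Nat.add_sub_cancel, mul_assoc] at h1
      have hne : ((N + 1 : ℕ) : k) ≠ 0 := fun h => hpN ((CharP.cast_eq_zero_iff k p _).1 h)
      have h2 := Ideal.mul_mem_left _ (C ((N + 1 : ℕ) : k)⁻¹) h1
      rw [← map_natCast (C : k →+* MvPolynomial (Fin (n + 2)) k), ← mul_assoc, ← C_mul,
        inv_mul_cancel₀ hne, C_1, one_mul] at h2
      simpa using h2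
  -- `m'` is the complement of `m` in the socle monomial `∏ xᵢ ^ (p ^ e - 1)`. If the bound fails,
  -- its degree is so large that `x ^ m'` lies in the Jacobian ideal modulo `𝔪^[p ^ e]`.
  let m' : Fin (n + 2) →₀ ℕ := Finsupp.equivFunOnFinite.symm fun i => p ^ e - 1 - m i
  have hdeg : m.degree = N * d := by
    by_contra h
    exact mem_support_iff.1 hm ((hg.pow N).coeff_eq_zero (by rwa [mul_comm]))
  have hsum : m.degree + m'.degree = (n + 2) * (p ^ e - 1) := by
    rw [Finsupp.degree_eq_sum, Finsupp.degree_eq_sum, ← Finset.sum_add_distrib]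
    rw [Finset.sum_congr rfl fun i _ => (show m i + m' i = p ^ e - 1 by
      have := hmQ i; simp [m']; lia)]
    simp
  have h1 := hJ _ (hc e m'.degree (by rw [add_mul] at hsum; lia) (monomial m' 1)
    (isHomogeneous_monomial 1 rfl))
  obtain ⟨i, hi⟩ := mem_frobPower_iff.1 h1 (m + m') (by
    rw [mem_support_iff, coeff_mul_monomial, mul_one]
    exact mem_support_iff.1 hm)
  have := hmQ i
  simp [m'] at hi
  lia

/-! ### Extremal singularities are Frobenius forms -/

theorem exists_eq_frobForm {q : ℕ} {f : MvPolynomial (Fin n) k} (hf : f.IsHomogeneous (q + 1))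
    (hmem : f ∈ frobPower k n q) : ∃ A, f = frobForm q A := by
  obtain ⟨c, hc⟩ := Ideal.mem_span_range_iff_exists_fun.1 hmem
  have h1 : ∀ i, ∃ a : Fin n → k, ∑ j, a j • (X j : MvPolynomial (Fin n) k) =
      homogeneousComponent 1 (c i) := fun i => by
    have h := homogeneousComponent_mem 1 (c i)
    rw [homogeneousSubmodule_one_eq_span_X] at h
    exact (Submodule.mem_span_range_iff_exists_fun k).1 h
  choose A hA using h1
  refine ⟨Matrix.of A, ?_⟩
  rw [← homogeneousComponent_eq_self hf, ← hc, map_sum]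
  refine Finset.sum_congr rfl fun i _ => ?_
  rw [add_comm q 1, homogeneousComponent_add_mul (isHomogeneous_X_pow i q), ← hA, Finset.sum_mul]
  refine Finset.sum_congr rfl fun j _ => ?_
  rw [smul_eq_C_mul, Matrix.of_apply]
  ring

/-- In at most one variable a form of degree at least `2` is not reduced. -/
theorem IsExtremal.two_le {p d : ℕ} {f : MvPolynomial (Fin n) k} (hf : IsExtremal p d f) :
    2 ≤ n := by
  by_contra! hn
  have h2 := hf.two_lt
  have hd : ∀ m ∈ f.support, m.degree = d := fun m hm => by
    by_contra h
    exact mem_support_iff.1 hm (hf.homogeneous.coeff_eq_zero h)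
  obtain ⟨m, hm⟩ := support_nonempty.2 hf.reduced.ne_zero
  obtain rfl | rfl : n = 0 ∨ n = 1 := by lia
  · have := hd m hm
    simp [Finsupp.degree_eq_sum] at this
    lia
  · have hdvd : (X 0 : MvPolynomial (Fin 1) k) * X 0 ∣ f := by
      rw [f.as_sum]
      refine Finset.dvd_sum fun m hm => ?_
      have := hd m hm
      rw [Finsupp.degree_eq_sum] at this
      simp only [Finset.univ_unique, Fin.default_eq_zero, Finset.sum_singleton] at this
      have h3 : X (0 : Fin 1) * X 0 = monomial (Finsupp.single (0 : Fin 1) 2) (1 : k) := by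
        rw [← pow_two, X_pow_eq_monomial]
      rw [h3, monomial_dvd_monomial]
      exact ⟨Or.inr (by simpa [this] using h2.le), one_dvd _⟩
    have hu := hf.reduced _ hdvd
    simpa using hu.map (eval (0 : Fin 1 → k))

theorem IsExtremal.mul_le {p d : ℕ} [Fact p.Prime] {f : MvPolynomial (Fin n) k}
    (hf : IsExtremal p d f) {N e : ℕ} (h : f ^ N ∉ frobPower k n (p ^ e)) :
    N * (d - 1) ≤ p ^ e := by
  have hd := hf.two_lt
  have hd' : (0 : ℝ) < (d : ℝ) - 1 := by
    have : (2 : ℝ) < d := by exact_mod_cast hd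
    linarith
  have hbdd : BddAbove {t : ℝ | ∃ N e : ℕ, f ^ N ∉ frobPower k n (p ^ e) ∧
      t = (N : ℝ) / (p : ℝ) ^ e} := by
    -- The supremum of an unbounded set would be `0`, which is not `1 / (d - 1)`.
    by_contra hb
    have := hf.fpt_eq
    rw [fpt, Real.sSup_of_not_bddAbove hb] at this
    have : (0 : ℝ) < 1 / ((d : ℝ) - 1) := by positivity
    linarith
  have h1 := le_csSup hbdd ⟨N, e, h, rfl⟩
  rw [← fpt, hf.fpt_eq] at h1
  have hp : (0 : ℝ) < (p : ℝ) ^ e := by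
    have := (Fact.out : p.Prime).pos
    positivity
  rw [div_le_div_iff₀ hp hd', one_mul] at h1
  have h2 : ((N * (d - 1) : ℕ) : ℝ) ≤ ((p ^ e : ℕ) : ℝ) := by
    push_cast [Nat.cast_sub (show 1 ≤ d by lia)]
    exact h1
  exact_mod_cast h2

/-- A reduced form of degree `d > 2` whose `F`-pure threshold is `1 / (d - 1)` is a Frobenius form.
With `μ e` the least `N` such that `f ^ N ∈ 𝔪^[p ^ e]`, the lower bound coming from the Jacobian
ideal forces `p ∣ μ e` for large `e`, so `μ e / p ^ e` is eventually constant, equal to the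
threshold. -/
theorem IsExtremal.exists_mem_frobPower {p d : ℕ} [Fact p.Prime] [CharP k p] [IsAlgClosed k]
    {f : MvPolynomial (Fin n) k} (hf : IsExtremal p d f) :
    ∃ e, 1 ≤ e ∧ d = p ^ e + 1 ∧ f ∈ frobPower k n (p ^ e) := by
  have hp : p.Prime := Fact.out
  have hd := hf.two_lt
  have hmul : ∀ {N e}, f ^ N ∉ frobPower k n (p ^ e) → N * (d - 1) ≤ p ^ e := hf.mul_le
  have hex : ∀ e, ∃ N, f ^ N ∈ frobPower k n (p ^ e) := fun e => by
    by_contra! H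
    have := hmul (H (p ^ e + 1))
    have h2 : (p ^ e + 1) * 1 ≤ (p ^ e + 1) * (d - 1) := Nat.mul_le_mul_left _ (by lia)
    lia
  classical
  let μ : ℕ → ℕ := fun e => Nat.find (hex e)
  have hμ : ∀ e, f ^ μ e ∈ frobPower k n (p ^ e) := fun e => Nat.find_spec (hex e)
  have hμ' : ∀ {N e}, f ^ N ∉ frobPower k n (p ^ e) ↔ N < μ e := by
    intro N e
    refine ⟨fun h => ?_, fun h => Nat.find_min (hex e) h⟩
    by_contra! hle
    refine h ?_
    rw [← Nat.sub_add_cancel hle, pow_add]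
    exact Ideal.mul_mem_left _ _ (hμ e)
  have hμpos : ∀ e, 0 < μ e := fun e => by
    rw [← hμ', pow_zero, mem_frobPower_iff]
    simp [support_one, hp.ne_zero]
  obtain ⟨e₀, he₀⟩ : ∃ e₀, ∀ e ≥ e₀, p ∣ μ e := by
    obtain ⟨m, rfl⟩ : ∃ m, n = m + 2 := ⟨n - 2, by have := hf.two_le; lia⟩
    obtain ⟨c, hc⟩ := exists_two_mul_le (p := p) hf.homogeneous (by lia) hf.reduced
    refine ⟨2 * c + 5, fun e he => ?_⟩
    by_contra hdvd
    have h0 := hμpos e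
    have hsub : μ e - 1 + 1 = μ e := by lia
    have h1 := hc e (by lia) (μ e - 1) (hμ'.2 (by lia)) (by rw [hsub]; exact hμ e)
      (by rwa [hsub])
    have h2 := hmul (hμ'.2 (show μ e - 1 < μ e by lia))
    have h3 : e < p ^ e := Nat.lt_pow_self hp.one_lt
    -- As `d ≥ 3`, the bound `h2` gives `(μ e - 1) d ≤ 3 p ^ e / 2`, against the `2 (p ^ e - 1) - c`
    -- of `h1`.
    obtain ⟨d, rfl⟩ : ∃ d', d = d' + 3 := ⟨d - 3, by lia⟩
    have h4 : (μ e - 1) * 2 ≤ (μ e - 1) * (d + 3 - 1) := Nat.mul_le_mul_left _ (by lia)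
    have h5 : (μ e - 1) * (d + 3) = (μ e - 1) * (d + 3 - 1) + (μ e - 1) := by
      rw [show d + 3 = d + 3 - 1 + 1 by lia]; simp [mul_add]
    lia
  have hstep : ∀ e ≥ e₀, μ (e + 1) = p * μ e := by
    intro e he
    obtain ⟨m, hm⟩ := he₀ (e + 1) (by lia)
    have h1 := hμ (e + 1)
    rw [hm, mul_comm, pow_mul, pow_succ', pow_char_mem_frobPower_iff] at h1
    have h2 : μ e ≤ m := Nat.find_min' _ h1
    have h3 : μ (e + 1) ≤ p * μ e := Nat.find_min' _ (by
      rw [mul_comm, pow_mul, pow_succ', pow_char_mem_frobPower_iff]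
      exact hμ e)
    exact le_antisymm h3 (hm ▸ Nat.mul_le_mul_left p h2)
  have hiter : ∀ j, μ (e₀ + j) = p ^ j * μ e₀ := by
    intro j
    induction j with
    | zero => simp
    | succ j ih => rw [← add_assoc, hstep _ (by lia), ih, pow_succ']; ring
  -- A failure of this bound, multiplied by `p ^ d` in `hiter`, would contradict `hmul`.
  have hle : μ e₀ * (d - 1) ≤ p ^ e₀ := by
    by_contra! hlt
    have h0 := hμpos (e₀ + d)
    have h1 := hmul (hμ'.2 (show μ (e₀ + d) - 1 < μ (e₀ + d) by lia))
    have h2 : d < p ^ d := Nat.lt_pow_self hp.one_lt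
    rw [Nat.sub_mul, hiter, pow_add] at h1
    have h3 : p ^ d * (p ^ e₀ + 1) ≤ p ^ d * (μ e₀ * (d - 1)) := Nat.mul_le_mul_left _ hlt
    have h4 : p ^ d * (p ^ e₀ + 1) = p ^ e₀ * p ^ d + p ^ d := by ring
    have h5 : p ^ d * μ e₀ * (d - 1) = p ^ d * (μ e₀ * (d - 1)) := by ring
    lia
  have hge : p ^ e₀ ≤ μ e₀ * (d - 1) := by
    have hd' : (0 : ℝ) < (d : ℝ) - 1 := by
      have : (2 : ℝ) < d := by exact_mod_cast hd
      linarith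
    have hpp : ∀ e, (0 : ℝ) < (p : ℝ) ^ e := fun e => by
      have := hp.pos
      positivity
    have h1 : fpt p f ≤ (μ e₀ : ℝ) / (p : ℝ) ^ e₀ := by
      refine Real.sSup_le ?_ (by positivity)
      rintro _ ⟨N, e, hN, rfl⟩
      rw [div_le_div_iff₀ (hpp e) (hpp e₀)]
      have h2 : f ^ (N * p ^ e₀) ∉ frobPower k n (p ^ (e + e₀)) := by
        rwa [pow_mul, pow_add, mul_comm (p ^ e), pow_char_pow_mem_frobPower_iff]
      have h3 : f ^ (μ e₀ * p ^ e) ∈ frobPower k n (p ^ (e + e₀)) := by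
        rw [pow_mul, pow_add, pow_char_pow_mem_frobPower_iff]
        exact hμ e₀
      have h4 : N * p ^ e₀ ≤ μ e₀ * p ^ e := by
        by_contra! hlt
        refine h2 ?_
        rw [← Nat.sub_add_cancel hlt.le, pow_add f]
        exact Ideal.mul_mem_left _ _ h3
      exact_mod_cast h4
    rw [hf.fpt_eq, div_le_div_iff₀ hd' (hpp e₀), one_mul] at h1
    have h2 : ((p ^ e₀ : ℕ) : ℝ) ≤ ((μ e₀ * (d - 1) : ℕ) : ℝ) := by
      push_cast [Nat.cast_sub (show 1 ≤ d by lia)]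
      exact h1
    exact_mod_cast h2
  have heq : μ e₀ * (d - 1) = p ^ e₀ := le_antisymm hle hge
  -- Hence `d - 1 = p ^ a`, and `f ^ p ^ b ∈ 𝔪^[p ^ (a + b)]` descends to `f ∈ 𝔪^[p ^ a]`.
  obtain ⟨a, -, ha⟩ := (Nat.dvd_prime_pow hp).1 (Dvd.intro_left _ heq)
  obtain ⟨b, -, hb⟩ := (Nat.dvd_prime_pow hp).1 (Dvd.intro _ heq)
  refine ⟨a, ?_, by lia, ?_⟩
  · by_contra! h0
    obtain rfl : a = 0 := by lia
    simp at ha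
    lia
  · have h1 := hμ e₀
    rwa [hb, ← heq, hb, ha, pow_char_pow_mem_frobPower_iff] at h1

theorem IsExtremal.exists_eq_frobForm {p d : ℕ} [Fact p.Prime] [CharP k p] [IsAlgClosed k]
    {f : MvPolynomial (Fin n) k} (hf : IsExtremal p d f) :
    ∃ e, 1 ≤ e ∧ d = p ^ e + 1 ∧ ∃ A, f = frobForm (p ^ e) A := by
  obtain ⟨e, he, hd, hmem⟩ := hf.exists_mem_frobPower
  exact ⟨e, he, hd, FrobThreshold.exists_eq_frobForm (hd ▸ hf.homogeneous) hmem⟩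

/-! ### Fixed vectors of Frobenius-semilinear maps -/

section Lang

variable {Q : ℕ} {τ : k →+* k} {V : Type*} [AddCommGroup V] [Module k V]
  [FiniteDimensional k V]

/-- The coordinates of a fixed vector of a cyclic Frobenius-semilinear map, as polynomials in the
last one. If `F xᵢ = xᵢ₊₁` for `i < r` and `F xᵣ = ∑ cᵢ xᵢ`, then `∑ Tᵢ xᵢ` is fixed by `F` if
`T₀ = c₀ Tᵣ^Q` and `Tᵢ₊₁ = Tᵢ^Q + cᵢ₊₁ Tᵣ^Q`. -/
def fixedCoord (Q : ℕ) (c : ℕ → k) : ℕ → Polynomial k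
  | 0 => Polynomial.C (c 0) * Polynomial.X ^ Q
  | i + 1 => fixedCoord Q c i ^ Q + Polynomial.C (c (i + 1)) * Polynomial.X ^ Q

theorem X_sq_dvd_fixedCoord (hQ : 1 < Q) (c : ℕ → k) (i : ℕ) :
    Polynomial.X ^ 2 ∣ fixedCoord Q c i := by
  have hX : (Polynomial.X : Polynomial k) ^ 2 ∣ Polynomial.X ^ Q := pow_dvd_pow _ hQ
  induction i with
  | zero => exact hX.mul_left _
  | succ i ih => exact (ih.trans (dvd_pow_self _ (by lia))).add (hX.mul_left _)

theorem coeff_eq_zero_of_fixedCoord_eq_zero (hQ : 1 < Q) (c : ℕ → k) (i : ℕ)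
    (h : fixedCoord Q c i = 0) : ∀ j ≤ i, c j = 0 := by
  induction i with
  | zero =>
    intro j hj
    obtain rfl : j = 0 := by lia
    simpa [fixedCoord] using h
  | succ i ih =>
    -- Otherwise `fixedCoord Q c i` would be linear, but it is divisible by `X ^ 2`.
    have hc : c (i + 1) = 0 := by
      by_contra hc
      have h1 : fixedCoord Q c i ^ Q = - Polynomial.C (c (i + 1)) * Polynomial.X ^ Q := by
        rw [fixedCoord] at h
        rw [neg_mul]
        exact eq_neg_of_add_eq_zero_left h
      obtain ⟨G, hG⟩ := X_sq_dvd_fixedCoord hQ c i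
      rw [hG, mul_pow, mul_comm, ← pow_mul, two_mul, pow_add, ← mul_assoc] at h1
      have h2 := mul_right_cancel₀ (pow_ne_zero Q Polynomial.X_ne_zero) h1
      have h3 := congrArg (Polynomial.eval 0) h2
      simp [show Q ≠ 0 by lia, hc] at h3
    have h1 : fixedCoord Q c i = 0 := by
      rw [fixedCoord, hc] at h
      simpa [show Q ≠ 0 by lia] using h
    intro j hj
    rcases Nat.lt_or_ge j (i + 1) with h2 | h2
    · exact ih h1 j (by lia)
    · rwa [show j = i + 1 by lia]

theorem exists_ne_zero_eval_fixedCoord_eq [IsAlgClosed k] (hQ : 1 < Q) (c : ℕ → k) (r : ℕ)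
    (hc : ∃ j ≤ r, c j ≠ 0) : ∃ t, t ≠ 0 ∧ (fixedCoord Q c r).eval t = t := by
  obtain ⟨G, hG⟩ := X_sq_dvd_fixedCoord hQ c r
  have hG0 : G ≠ 0 := by
    rintro rfl
    obtain ⟨j, hj, hcj⟩ := hc
    exact hcj (coeff_eq_zero_of_fixedCoord_eq_zero hQ c r (by simpa using hG) j hj)
  have hdeg : (Polynomial.X * G - Polynomial.C 1).degree ≠ 0 := by
    rw [Polynomial.degree_sub_C]
    · simp only [Polynomial.degree_mul, Polynomial.degree_X]
      rw [Polynomial.degree_eq_natDegree hG0]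
      norm_cast
      lia
    · simp only [Polynomial.degree_mul, Polynomial.degree_X]
      rw [Polynomial.degree_eq_natDegree hG0]
      norm_cast
      lia
  obtain ⟨t, ht⟩ := IsAlgClosed.exists_root _ hdeg
  have ht' : t * G.eval t = 1 := by
    simpa [Polynomial.IsRoot, sub_eq_zero] using ht
  refine ⟨t, left_ne_zero_of_mul_eq_one ht', ?_⟩
  rw [hG, Polynomial.eval_mul, Polynomial.eval_pow, Polynomial.eval_X, pow_two, mul_assoc, ht',
    mul_one]

/-- An injective Frobenius-semilinear endomorphism of a nonzero space has a nonzero fixed vector: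
restrict it to a cyclic subspace and solve for the coordinates of the vector. -/
theorem exists_ne_zero_fixed [IsAlgClosed k] [Nontrivial V] (hQ : 1 < Q) (hτ : ∀ x, τ x = x ^ Q)
    (F : V →ₛₗ[τ] V) (hF : Function.Injective F) : ∃ v, v ≠ 0 ∧ F v = v := by
  obtain ⟨w, hw⟩ := exists_ne (0 : V)
  let x : ℕ → V := fun i => F^[i] w
  have hx : ∀ i, F (x i) = x (i + 1) := fun i => (Function.iterate_succ_apply' F i w).symm
  have hx0 : ∀ i, x i ≠ 0 := by
    intro i
    induction i with
    | zero => exact hw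
    | succ i ih => rw [← hx]; exact (map_ne_zero_iff F hF).2 ih
  have hex : ∃ m, ¬ LinearIndependent k (fun i : Fin m => x i) :=
    ⟨Module.finrank k V + 1, fun h => by simpa using h.fintype_card_le_finrank⟩
  classical
  obtain ⟨m, hm, hmin⟩ : ∃ m, ¬ LinearIndependent k (fun i : Fin (m + 1) => x i) ∧
      LinearIndependent k (fun i : Fin m => x i) := by
    obtain ⟨m, hm⟩ : ∃ m, Nat.find hex = m + 1 := Nat.exists_eq_succ_of_ne_zero fun h0 =>
      (h0 ▸ Nat.find_spec hex) linearIndependent_empty_type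
    exact ⟨m, hm ▸ Nat.find_spec hex, not_not.1 (Nat.find_min hex (by lia))⟩
  have hmem : x m ∈ Submodule.span k (Set.range fun i : Fin m => x i) := by
    by_contra h
    exact hm (linearIndependent_finSucc'.2 ⟨hmin, h⟩)
  obtain ⟨c', hc'⟩ := (Submodule.mem_span_range_iff_exists_fun k).1 hmem
  let c : ℕ → k := fun i => if h : i < m then c' ⟨i, h⟩ else 0
  have hc : ∑ i ∈ Finset.range m, c i • x i = x m := by
    rw [← hc', Finset.sum_range]
    exact Finset.sum_congr rfl fun i _ => by simp [c]
  obtain ⟨r, rfl⟩ : ∃ r, m = r + 1 := Nat.exists_eq_succ_of_ne_zero fun h0 => by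
    subst h0
    exact hx0 0 (by simpa using hc.symm)
  obtain ⟨t, ht0, ht⟩ := exists_ne_zero_eval_fixedCoord_eq hQ c r (by
    by_contra! H
    refine hx0 (r + 1) ?_
    rw [← hc]
    exact Finset.sum_eq_zero fun i hi => by
      rw [H i (by simpa [Nat.lt_succ_iff] using hi), zero_smul])
  let T : ℕ → k := fun i => (fixedCoord Q c i).eval t
  have hT0 : T 0 = c 0 * t ^ Q := by simp [T, fixedCoord]
  have hTs : ∀ i, T (i + 1) = T i ^ Q + c (i + 1) * t ^ Q := fun i => by simp [T, fixedCoord]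
  refine ⟨∑ i ∈ Finset.range (r + 1), T i • x i, fun h0 => ht0 ?_, ?_⟩
  · rw [Finset.sum_range] at h0
    have := Fintype.linearIndependent_iff.1 hmin (fun i => T i) h0 (Fin.last r)
    rwa [← ht]
  · rw [map_sum]
    simp_rw [LinearMap.map_smulₛₗ, hτ, hx]
    rw [Finset.sum_range_succ, ← hc, Finset.sum_range_succ' _ r, Finset.sum_range_succ' _ r, hT0,
      show T r = t from ht]
    simp_rw [hTs, add_smul, Finset.sum_add_distrib, smul_add, Finset.smul_sum, smul_smul]
    rw [add_assoc, mul_comm (c 0)]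
    simp_rw [mul_comm (c _)]

/-- Fixed vectors of an injective Frobenius-semilinear endomorphism `F` span the space: a fixed
vector of the quotient by their span `S` would lift to a fixed vector, because `F - 1` maps `S` onto
itself. -/
theorem span_fixed_eq_top [IsAlgClosed k] (hQ : 1 < Q) (hτ : ∀ x, τ x = x ^ Q) (F : V →ₛₗ[τ] V)
    (hF : Function.Injective F) : Submodule.span k {v | F v = v} = ⊤ := by
  set S := Submodule.span k {v | F v = v} with hS
  by_contra hne
  have hle : S ≤ S.comap F := Submodule.span_le.2 fun v hv => by
    simp only [Submodule.comap_coe, Set.mem_preimage]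
    rw [show F v = v from hv]
    exact Submodule.subset_span hv
  have hsurj : ∀ s ∈ S, ∃ s' ∈ S, F s' = s := by
    intro s hs
    induction hs using Submodule.span_induction with
    | mem v hv => exact ⟨v, Submodule.subset_span hv, hv⟩
    | zero => exact ⟨0, S.zero_mem, map_zero F⟩
    | add x y _ _ hx hy =>
      obtain ⟨x', hx', rfl⟩ := hx
      obtain ⟨y', hy', rfl⟩ := hy
      exact ⟨x' + y', S.add_mem hx' hy', map_add F _ _⟩
    | smul a x _ hx =>
      obtain ⟨x', hx', rfl⟩ := hx
      obtain ⟨b, rfl⟩ := IsAlgClosed.exists_pow_nat_eq a (show 0 < Q by lia)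
      exact ⟨b • x', S.smul_mem _ hx', by rw [LinearMap.map_smulₛₗ, hτ]⟩
  have hAS : ∀ s ∈ S, ∃ u ∈ S, F u - u = s := by
    intro s hs
    induction hs using Submodule.closure_induction with
    | zero => exact ⟨0, S.zero_mem, by simp⟩
    | add x y _ _ hx hy =>
      obtain ⟨x', hx', rfl⟩ := hx
      obtain ⟨y', hy', rfl⟩ := hy
      exact ⟨x' + y', S.add_mem hx' hy', by rw [map_add]; abel⟩
    | smul_mem a x hx =>
      have hdeg : (Polynomial.X ^ Q - Polynomial.X - Polynomial.C a : Polynomial k).degree ≠ 0 := by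
        have h1 : (Polynomial.X ^ Q - Polynomial.X - Polynomial.C a : Polynomial k) =
            Polynomial.X ^ Q - (Polynomial.X + Polynomial.C a) := by ring
        rw [h1, Polynomial.degree_sub_eq_left_of_degree_lt, Polynomial.degree_X_pow]
        · norm_cast
          lia
        · rw [Polynomial.degree_X_add_C, Polynomial.degree_X_pow]
          exact_mod_cast hQ
      obtain ⟨b, hb⟩ := IsAlgClosed.exists_root _ hdeg
      refine ⟨b • x, S.smul_mem _ (Submodule.subset_span hx), ?_⟩
      have hb' : b ^ Q - b = a := by simpa [Polynomial.IsRoot, sub_eq_zero] using hb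
      rw [LinearMap.map_smulₛₗ, hτ, show F x = x from hx, ← sub_smul, hb']
  have := Submodule.Quotient.nontrivial_iff.2 hne
  obtain ⟨v', hv0, hv⟩ := exists_ne_zero_fixed hQ hτ (S.mapQ S F hle) (by
    rw [injective_iff_map_eq_zero]
    intro a ha
    obtain ⟨a, rfl⟩ := S.mkQ_surjective a
    simp only [Submodule.mkQ_apply, Submodule.mapQ_apply, Submodule.Quotient.mk_eq_zero] at ha ⊢
    obtain ⟨s, hs, hsa⟩ := hsurj _ ha
    exact hF hsa ▸ hs)
  obtain ⟨v, rfl⟩ := S.mkQ_surjective v'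
  simp only [Submodule.mkQ_apply, Submodule.mapQ_apply, ne_eq,
    Submodule.Quotient.mk_eq_zero] at hv0 hv
  obtain ⟨u, huS, hu⟩ := hAS _ ((Submodule.Quotient.eq S).1 hv)
  have hfix : v - u ∈ S := Submodule.subset_span (by
    rw [Set.mem_ofPred_eq, map_sub, sub_eq_sub_iff_sub_eq_sub, ← hu])
  exact hv0 (by simpa using S.add_mem hfix huS)

end Lang

/-! ### Congruence of Frobenius forms -/

section Congr

variable {ι κ μ : Type*} [Fintype ι] [Fintype κ] [Fintype μ] [DecidableEq ι] [DecidableEq κ]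
  [DecidableEq μ] {σ : k ≃+* k}

/-- Twisted congruence `B = σ(g)ᵀ A g` with `g` invertible. The index types may differ, so that
reindexing is a special case. -/
def Congruent (σ : k ≃+* k) (A : Matrix ι ι k) (B : Matrix κ κ k) : Prop :=
  ∃ (g : Matrix ι κ k) (h : Matrix κ ι k), g * h = 1 ∧ h * g = 1 ∧ (g.map σ).transpose * A * g = B

theorem Congruent.trans {A : Matrix ι ι k} {B : Matrix κ κ k} {D : Matrix μ μ k}
    (hAB : Congruent σ A B) (hBD : Congruent σ B D) : Congruent σ A D := by
  obtain ⟨g, h, h1, h2, rfl⟩ := hAB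
  obtain ⟨g', h', h1', h2', rfl⟩ := hBD
  refine ⟨g * g', h' * h, ?_, ?_, ?_⟩
  · rw [Matrix.mul_assoc, ← Matrix.mul_assoc g', h1', Matrix.one_mul, h1]
  · rw [Matrix.mul_assoc, ← Matrix.mul_assoc h, h2, Matrix.one_mul, h2']
  · rw [Matrix.map_mul, Matrix.transpose_mul]
    simp only [Matrix.mul_assoc]

theorem Congruent.symm {A : Matrix ι ι k} {B : Matrix κ κ k}
    (hAB : Congruent σ A B) : Congruent σ B A := by
  obtain ⟨g, h, h1, h2, rfl⟩ := hAB
  have h3 : (h.map σ).transpose * (g.map σ).transpose = 1 := by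
    rw [← Matrix.transpose_mul, ← Matrix.map_mul, h1]
    simp
  refine ⟨h, g, h2, h1, ?_⟩
  calc (h.map σ).transpose * ((g.map σ).transpose * A * g) * h
      = ((h.map σ).transpose * (g.map σ).transpose) * A * (g * h) := by simp only [Matrix.mul_assoc]
    _ = A := by rw [h1, h3, Matrix.one_mul, Matrix.mul_one]

theorem Congruent.submatrix_equiv (A : Matrix ι ι k) (e : κ ≃ ι) :
    Congruent σ A (A.submatrix e e) := by
  refine ⟨(1 : Matrix ι ι k).submatrix id e, (1 : Matrix ι ι k).submatrix e id, ?_, ?_, ?_⟩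
  · have := Matrix.submatrix_mul_equiv (1 : Matrix ι ι k) (1 : Matrix ι ι k) id e id
    rw [this]; simp
  · have := Matrix.submatrix_mul_equiv (1 : Matrix ι ι k) (1 : Matrix ι ι k) e (Equiv.refl ι) e
    simp at this ⊢
    exact this
  · ext i j
    simp [Matrix.mul_apply, Matrix.one_apply, apply_ite σ]

/-- The Frobenius automorphism `x ↦ x ^ (p ^ e)` of a perfect field. -/
abbrev frob (k : Type*) [Field k] (p : ℕ) [Fact p.Prime] [CharP k p] [PerfectRing k p] (e : ℕ) :
    k ≃+* k := iterateFrobeniusEquiv k p e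

/-- Linear substitutions act on Frobenius forms by twisted congruence, since `x ↦ x ^ p ^ e` is
additive. -/
theorem linSubst_frobForm {p : ℕ} [Fact p.Prime] [CharP k p] [PerfectRing k p] (e : ℕ)
    (g A : Matrix (Fin n) (Fin n) k) :
    linSubst g (frobForm (p ^ e) A) =
      frobForm (p ^ e) ((g.map (frob k p e)).transpose * A * g) := by
  have hform : ∀ B : Matrix (Fin n) (Fin n) k, frobForm (p ^ e) B =
      (fun i => (X i : MvPolynomial (Fin n) k) ^ p ^ e) ⬝ᵥ (B.map C).mulVec X := by
    intro B
    simp only [frobForm, dotProduct, Matrix.mulVec, Finset.mul_sum, Matrix.map_apply]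
    refine Finset.sum_congr rfl fun i _ => Finset.sum_congr rfl fun j _ => by ring
  have hsub : linSubst g (frobForm (p ^ e) A) =
      (fun i => (((g.map C).mulVec X) i : MvPolynomial (Fin n) k) ^ p ^ e) ⬝ᵥ
        (A.map C).mulVec ((g.map C).mulVec X) := by
    have hX : ∀ i, linSubst g (X i) = ((g.map C).mulVec X) i := fun i => by
      simp [linSubst, Matrix.mulVec, dotProduct]
    have hC : ∀ a, linSubst g (C a) = C a := fun a => by simp [linSubst]
    generalize (g.map C).mulVec X = Y at hX ⊢
    simp only [frobForm, dotProduct, map_sum, map_mul, map_pow, hC, hX, Matrix.mulVec,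
      Finset.mul_sum, Matrix.map_apply]
    refine Finset.sum_congr rfl fun i _ => Finset.sum_congr rfl fun j _ => by ring
  have hpow : (fun i => (((g.map C).mulVec X) i : MvPolynomial (Fin n) k) ^ p ^ e) =
      ((g.map (frob k p e)).map C).mulVec fun i => X i ^ p ^ e := by
    funext i
    simp only [Matrix.mulVec, dotProduct, sum_pow_char_pow, mul_pow, Matrix.map_apply]
    refine Finset.sum_congr rfl fun j _ => ?_
    rw [iterateFrobeniusEquiv_def, map_pow]
  rw [hsub, hpow, hform, Matrix.map_mul, Matrix.map_mul, Matrix.transpose_map,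
    ← Matrix.mulVec_mulVec, ← Matrix.mulVec_mulVec, ← Matrix.vecMul_transpose,
    ← Matrix.dotProduct_mulVec]

theorem Congruent.isoClass_eq {p : ℕ} [Fact p.Prime] [CharP k p] [PerfectRing k p] {e : ℕ}
    {A B : Matrix (Fin n) (Fin n) k} (h : Congruent (frob k p e) A B) :
    isoClass (frobForm (p ^ e) A) = isoClass (frobForm (p ^ e) B) := by
  obtain ⟨g, h, h1, h2, rfl⟩ := h
  exact Quotient.sound ⟨⟨g, h, h1, h2⟩, linSubst_frobForm e g A⟩

end Congr

/-! ### Nondegenerate Frobenius forms are diagonalizable -/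

/-- The form `σ(x)ᵀ A y`, semilinear in `x` and linear in `y`. -/
def sesq (σ : k →+* k) (A : Matrix (Fin n) (Fin n) k) :
    (Fin n → k) →ₛₗ[σ] (Fin n → k) →ₗ[k] k :=
  LinearMap.mk₂'ₛₗ σ (RingHom.id k) (fun x y => (fun i => σ (x i)) ⬝ᵥ A.mulVec y)
    (fun x x' y => by simp [dotProduct, add_mul, Finset.sum_add_distrib])
    (fun c x y => by simp [dotProduct, Finset.mul_sum, mul_assoc])
    (fun x y y' => by rw [Matrix.mulVec_add, dotProduct_add])
    (fun c x y => by rw [Matrix.mulVec_smul, dotProduct_smul]; rfl)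

theorem sesq_apply (σ : k →+* k) (A : Matrix (Fin n) (Fin n) k) (x y : Fin n → k) :
    sesq σ A x y = (fun i => σ (x i)) ⬝ᵥ A.mulVec y := rfl

section Hermitian

variable [IsAlgClosed k] {q : ℕ} {σ : k →+* k} {A : Matrix (Fin n) (Fin n) k}

/-- The vectors on which the sesquilinear form of `A` is Hermitian span the space: they are the
fixed vectors of the semilinear map `v ↦ A⁻¹ σ(A)ᵀ σ²(v)`. -/
theorem span_hermitian_eq_top (hq : 1 < q) (hσ : ∀ x, σ x = x ^ q) (hA : IsUnit A.det) :
    Submodule.span k {v | ∀ y, sesq σ A y v = σ (sesq σ A v y)} = ⊤ := by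
  let F : (Fin n → k) →ₛₗ[σ.comp σ] (Fin n → k) :=
    { toFun := fun v => A⁻¹.mulVec ((A.map σ).transpose.mulVec fun i => σ (σ (v i)))
      map_add' := fun v w => by
        rw [← Matrix.mulVec_add, ← Matrix.mulVec_add]
        congr 2
        funext i
        simp
      map_smul' := fun c v => by
        rw [← Matrix.mulVec_smul, ← Matrix.mulVec_smul]
        congr 2
        funext i
        simp }
  have hF : Function.Injective F := by
    intro v w hvw
    have h1 : IsUnit A⁻¹ := (Matrix.isUnit_iff_isUnit_det _).2 (Matrix.isUnit_nonsing_inv_det A hA)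
    have h2 : IsUnit (A.map σ).transpose := by
      rw [Matrix.isUnit_transpose]
      exact ((Matrix.isUnit_iff_isUnit_det _).2 hA).map σ.mapMatrix
    have h3 := Matrix.mulVec_injective_of_isUnit h2 (Matrix.mulVec_injective_of_isUnit h1 hvw)
    funext i
    exact σ.injective (σ.injective (congrFun h3 i))
  have htop := span_fixed_eq_top (Q := q * q) (by nlinarith)
    (fun x => by rw [RingHom.comp_apply, hσ, hσ, pow_mul]) F hF
  rw [← top_le_iff, ← htop]
  refine Submodule.span_mono fun v hv y => ?_
  have hv' : A.mulVec v = (A.map σ).transpose.mulVec fun i => σ (σ (v i)) := by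
    conv_lhs => rw [← show F v = v from hv]
    simp only [F, LinearMap.coe_mk, AddHom.coe_mk, Matrix.mulVec_mulVec,
      Matrix.mul_nonsing_inv_cancel_left _ _ hA]
  rw [sesq_apply, hv', sesq_apply, Matrix.dotProduct_mulVec, Matrix.vecMul_transpose,
    dotProduct_comm]
  simp only [dotProduct, map_sum, map_mul, Matrix.mulVec, Matrix.map_apply]

/-- An orthonormal family of Hermitian vectors that does not span extends by one more vector. -/
theorem exists_hermitian_orthonormal_snoc (hq : 1 < q) (hσ : ∀ x, σ x = x ^ q) (hA : IsUnit A.det)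
    {m : ℕ} (hm : m < n) (v : Fin m → Fin n → k)
    (hv : ∀ i y, sesq σ A y (v i) = σ (sesq σ A (v i) y))
    (hvv : ∀ i j, sesq σ A (v i) (v j) = if i = j then 1 else 0) :
    ∃ u, (∀ y, sesq σ A y u = σ (sesq σ A u y)) ∧ (∀ i, sesq σ A (v i) u = 0) ∧
      sesq σ A u u = 1 := by
  set B := sesq σ A with hB
  let H : Set (Fin n → k) := {v | ∀ y, B y v = σ (B v y)}
  have hspan : Submodule.span k H = ⊤ := span_hermitian_eq_top hq hσ hA
  have hHsmul : ∀ u ∈ H, ∀ a, σ (σ a) = a → a • u ∈ H := by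
    intro u hu a ha y
    rw [map_smul, LinearMap.map_smulₛₗ, LinearMap.smul_apply, smul_eq_mul, smul_eq_mul, map_mul,
      ha, hu y]
  have hHadd : ∀ u ∈ H, ∀ w ∈ H, u + w ∈ H := by
    intro u hu w hw y
    rw [map_add, map_add, LinearMap.add_apply, map_add, hu y, hw y]
  have hval : ∀ u ∈ H, ∀ w ∈ H, σ (σ (B u w)) = B u w := by
    intro u hu w hw
    rw [← hu w, ← hw u]
  have hproj : ∀ w ∈ H, w - ∑ i, B (v i) w • v i ∈ H := by
    intro w hw
    rw [sub_eq_add_neg, ← Finset.sum_neg_distrib]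
    refine hHadd _ hw _ (Finset.sum_induction _ (· ∈ H) (fun a b ha hb => hHadd a ha b hb)
      (fun y => by simp) fun i _ => ?_)
    rw [← neg_smul]
    exact hHsmul _ (hv i) _ (by rw [map_neg, map_neg, hval _ (hv i) _ hw])
  have hproj0 : ∀ w, ∀ i, B (v i) (w - ∑ j, B (v j) w • v j) = 0 := by
    intro w i
    simp [hvv]
  -- A Hermitian form that vanishes on the diagonal is zero, by polarization: with `σ z + z = 1`,
  -- some `a` has `B (u + a w) (u + a w) = σ z + z = 1` unless `B u w = 0`.
  obtain ⟨u, huH, hu0, huu⟩ : ∃ u ∈ H, (∀ i, B (v i) u = 0) ∧ B u u ≠ 0 := by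
    by_contra! hall
    have hpol : ∀ u ∈ H, (∀ i, B (v i) u = 0) → ∀ w ∈ H, (∀ i, B (v i) w = 0) → B u w = 0 := by
      intro u hu hu0 w hw hw0
      by_contra hb
      have hdeg :
          (Polynomial.X ^ q + (Polynomial.X - Polynomial.C 1) : Polynomial k).degree ≠ 0 := by
        rw [Polynomial.degree_add_eq_left_of_degree_lt, Polynomial.degree_X_pow]
        · norm_cast
          lia
        · rw [Polynomial.degree_X_sub_C, Polynomial.degree_X_pow]
          exact_mod_cast hq
      obtain ⟨z, hz⟩ := IsAlgClosed.exists_root _ hdeg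
      have hz1 : σ z = 1 - z := by
        simp only [Polynomial.IsRoot, Polynomial.eval_add, Polynomial.eval_pow, Polynomial.eval_X,
          Polynomial.eval_sub, Polynomial.eval_C] at hz
        rw [hσ]
        linear_combination hz
      have hz2 : σ (σ z) = z := by rw [hz1, map_sub, map_one, hz1]; ring
      have haH : (z / B u w) • w ∈ H :=
        hHsmul w hw _ (by rw [map_div₀, map_div₀, hz2, hval u hu w hw])
      have h1 := hall (u + (z / B u w) • w) (hHadd _ hu _ haH) (fun i => by simp [hu0, hw0])
      have h2 : B u ((z / B u w) • w) = z := by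
        rw [map_smul, smul_eq_mul, div_mul_cancel₀ _ hb]
      simp only [map_add, LinearMap.add_apply] at h1
      rw [hall u hu hu0, hall _ haH (fun i => by simp [hw0]), hu ((z / B u w) • w), h2, hz1] at h1
      exact one_ne_zero (α := k) (by linear_combination h1)
    have hzero : ∀ u ∈ H, (∀ i, B (v i) u = 0) → u = 0 := by
      intro u hu hu0
      have h1 : B u = 0 := by
        refine LinearMap.ext_on hspan fun w hw => ?_
        have h2 := hpol u hu hu0 _ (hproj w hw) (hproj0 w)
        rw [map_sub, map_sum, sub_eq_zero] at h2
        rw [h2, LinearMap.zero_apply]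
        refine Finset.sum_eq_zero fun i _ => ?_
        rw [map_smul, hv i u, hu0 i, map_zero, smul_zero]
      have h3 : Matrix.vecMul (fun i => σ (u i)) A = 0 := by
        funext j
        have := congr($h1 (Pi.single j 1))
        rw [hB, sesq_apply, Matrix.dotProduct_mulVec] at this
        simpa using this
      have h4 : (fun i => σ (u i)) = 0 := by
        have := congrArg (fun x => Matrix.vecMul x A⁻¹) h3
        simpa [Matrix.vecMul_vecMul, Matrix.mul_nonsing_inv _ hA] using this
      funext i
      exact (map_eq_zero σ).1 (congrFun h4 i)
    have hle : (⊤ : Submodule k (Fin n → k)) ≤ Submodule.span k (Set.range v) := by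
      rw [← hspan, Submodule.span_le]
      intro w hw
      rw [SetLike.mem_coe, sub_eq_zero.1 (hzero _ (hproj w hw) (hproj0 w))]
      exact Submodule.sum_mem _ fun i _ => Submodule.smul_mem _ _ (Submodule.subset_span ⟨i, rfl⟩)
    have := finrank_range_le_card (R := k) v
    rw [Set.finrank, top_le_iff.1 hle, finrank_top, Module.finrank_fin_fun,
      Fintype.card_fin] at this
    lia
  -- Rescale `u` by a `(q + 1)`-st root; as `B u u` is fixed by `σ`, the root is fixed by `σ²`.
  have hc : σ (B u u) = B u u := (huH u).symm
  obtain ⟨l, hl⟩ := IsAlgClosed.exists_pow_nat_eq (B u u)⁻¹ (show 0 < q + 1 by lia)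
  have hl0 : l ≠ 0 := by
    rintro rfl
    rw [zero_pow (by lia)] at hl
    exact inv_ne_zero huu hl.symm
  have hll : σ l * l = (B u u)⁻¹ := by rw [hσ, ← hl, pow_succ]
  have hl2 : σ (σ l) = l := by
    have h1 := congrArg σ hll
    rw [map_mul, map_inv₀, hc, ← hll, mul_comm (σ l) l] at h1
    exact mul_right_cancel₀ ((map_ne_zero σ).2 hl0) h1
  refine ⟨l • u, hHsmul u huH l hl2, fun i => by simp [hu0], ?_⟩
  rw [map_smul, LinearMap.map_smulₛₗ, LinearMap.smul_apply, smul_eq_mul, smul_eq_mul, ← mul_assoc,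
    mul_comm l, hll, inv_mul_cancel₀ huu]

theorem exists_hermitian_orthonormal (hq : 1 < q) (hσ : ∀ x, σ x = x ^ q) (hA : IsUnit A.det)
    (m : ℕ) (hm : m ≤ n) : ∃ v : Fin m → Fin n → k,
      (∀ i y, sesq σ A y (v i) = σ (sesq σ A (v i) y)) ∧
      ∀ i j, sesq σ A (v i) (v j) = if i = j then 1 else 0 := by
  induction m with
  | zero => exact ⟨Fin.elim0, fun i => i.elim0, fun i => i.elim0⟩
  | succ m ih =>
    obtain ⟨v, hv, hvv⟩ := ih (by lia)
    obtain ⟨u, hu, hvu, huu⟩ := exists_hermitian_orthonormal_snoc hq hσ hA (by lia) v hv hvv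
    refine ⟨Fin.snoc v u, fun i => ?_, fun i j => ?_⟩
    · refine Fin.lastCases ?_ (fun i => ?_) i
      · simpa using hu
      · simpa using hv i
    · refine Fin.lastCases ?_ (fun i => ?_) i <;> refine Fin.lastCases ?_ (fun j => ?_) j
      · simpa using huu
      · have h1 : sesq σ A u (v j) = 0 := by rw [hv j u, hvu, map_zero]
        simp [h1, (Fin.castSucc_lt_last j).ne']
      · simp [hvu, (Fin.castSucc_lt_last i).ne]
      · simp [hvv]

end Hermitian

/-- Lang's theorem for twisted congruence: an invertible matrix is twisted congruent to `1`. -/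
theorem congruent_one_of_isUnit_det {p : ℕ} [Fact p.Prime] [CharP k p] [IsAlgClosed k] {e : ℕ}
    (he : e ≠ 0) {A : Matrix (Fin n) (Fin n) k} (hA : IsUnit A.det) :
    Congruent (frob k p e) A (1 : Matrix (Fin n) (Fin n) k) := by
  have hq : 1 < p ^ e := Nat.one_lt_pow he (Fact.out : p.Prime).one_lt
  obtain ⟨v, -, hvv⟩ := exists_hermitian_orthonormal (σ := (frob k p e : k →+* k)) hq
    (fun x => by simp [iterateFrobenius_def]) hA n le_rfl
  let g : Matrix (Fin n) (Fin n) k := Matrix.of fun i j => v j i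
  have hg : (g.map (frob k p e)).transpose * A * g = 1 := by
    ext i j
    rw [Matrix.one_apply, ← hvv i j, sesq_apply, Matrix.dotProduct_mulVec]
    rfl
  have hdet : IsUnit g.det := by
    have := congrArg Matrix.det hg
    rw [Matrix.det_mul, Matrix.det_one] at this
    exact IsUnit.of_mul_eq_one_right _ this
  exact ⟨g, g⁻¹, Matrix.mul_nonsing_inv _ hdet, Matrix.nonsing_inv_mul _ hdet, hg⟩

/-! ### Reduction of degenerate Frobenius forms -/

section Block

variable {σ : k ≃+* k} {s u m : ℕ}

/-- The pairing between the right kernel of a Frobenius form and a complement of its annihilator: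
the last `u` kernel vectors lie in the left kernel too. -/
def pairingBlock (k : Type*) [Field k] (s u m : ℕ) :
    Matrix (Fin s ⊕ Fin u) (Fin m ⊕ Fin s) k :=
  Matrix.fromBlocks 0 1 0 0

/-- The normal form of a Frobenius form with right kernel of dimension `s + u`: with variables
`r` (`s` of them), `z` (`u` of them, not occurring), `h` (`m` of them) and `c` (`s` of them), it is
the polynomial `∑ rᵢ^q cᵢ + ∑ A₁ᵢⱼ hᵢ^q hⱼ + ∑ Cᵢⱼ cᵢ^q hⱼ`. -/
def blockForm (u : ℕ) (A₁ : Matrix (Fin m) (Fin m) k) (C : Matrix (Fin s) (Fin m) k) :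
    Matrix ((Fin s ⊕ Fin u) ⊕ (Fin m ⊕ Fin s)) ((Fin s ⊕ Fin u) ⊕ (Fin m ⊕ Fin s)) k :=
  Matrix.fromBlocks 0 (pairingBlock k s u m) 0 (Matrix.fromBlocks A₁ 0 C 0)

/-- The columns of `A₁` stacked on `C` are independent. -/
def StackInjective (A₁ : Matrix (Fin m) (Fin m) k) (C : Matrix (Fin s) (Fin m) k) : Prop :=
  ∀ v, A₁.mulVec v = 0 → C.mulVec v = 0 → v = 0

theorem congruent_fromBlocks {ρ ω : Type*} [Fintype ρ] [Fintype ω] [DecidableEq ρ] [DecidableEq ω]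
    (N : Matrix ρ ω k) (M : Matrix ω ω k) {a a' : Matrix ρ ρ k} {b b' : Matrix ω ω k}
    (ha : a * a' = 1) (ha' : a' * a = 1) (hb : b * b' = 1) (hb' : b' * b = 1) :
    Congruent σ (Matrix.fromBlocks 0 N 0 M)
      (Matrix.fromBlocks 0 ((a.map σ).transpose * N * b) 0 ((b.map σ).transpose * M * b)) := by
  refine ⟨Matrix.fromBlocks a 0 0 b, Matrix.fromBlocks a' 0 0 b', ?_, ?_, ?_⟩
  · simp [Matrix.fromBlocks_multiply, ha, hb]
  · simp [Matrix.fromBlocks_multiply, ha', hb']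
  · simp [Matrix.fromBlocks_multiply, Matrix.fromBlocks_map, Matrix.fromBlocks_transpose]

/-- Adding multiples of the rows of the pairing block clears the columns `D` and `E` below its
identity block. The accompanying column operation only touches columns of zeros. -/
theorem congruent_blockForm_of_fromBlocks (A₁ : Matrix (Fin m) (Fin m) k)
    (D : Matrix (Fin m) (Fin s) k) (C : Matrix (Fin s) (Fin m) k) (E : Matrix (Fin s) (Fin s) k) :
    Congruent σ (Matrix.fromBlocks 0 (pairingBlock k s u m) 0 (Matrix.fromBlocks A₁ D C E))
      (blockForm u A₁ C) := by
  let Y : Matrix (Fin m ⊕ Fin s) (Fin s ⊕ Fin u) k := Matrix.fromBlocks (-D) 0 (-E) 0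
  let X : Matrix (Fin s ⊕ Fin u) (Fin m ⊕ Fin s) k := (Y.map σ.symm).transpose
  have hX : (X.map σ).transpose = Y := by
    ext i j
    simp [X]
  refine ⟨Matrix.fromBlocks 1 X 0 1, Matrix.fromBlocks 1 (-X) 0 1, ?_, ?_, ?_⟩
  · simp [Matrix.fromBlocks_multiply]
  · simp [Matrix.fromBlocks_multiply]
  · simp only [Matrix.fromBlocks_map, Matrix.fromBlocks_transpose, Matrix.fromBlocks_multiply, hX]
    simp [Y, blockForm, pairingBlock, Matrix.fromBlocks_multiply, Matrix.fromBlocks_add]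

theorem exists_mul_eq_of_ker_le {s t m : ℕ} (A : Matrix (Fin t) (Fin m) k)
    (D : Matrix (Fin s) (Fin m) k) (h : ∀ v, A.mulVec v = 0 → D.mulVec v = 0) :
    ∃ Y : Matrix (Fin s) (Fin t) k, Y * A = D := by
  obtain ⟨g, hg⟩ := LinearMap.exists_extend
    (((LinearMap.ker A.mulVecLin).liftQ D.mulVecLin h).comp
      A.mulVecLin.quotKerEquivRange.symm.toLinearMap)
  refine ⟨LinearMap.toMatrix' g, ?_⟩
  apply Matrix.toLin'.injective
  rw [Matrix.toLin'_mul, Matrix.toLin'_toMatrix']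
  refine LinearMap.ext fun v => ?_
  have h1 := congr($hg ⟨A.mulVecLin v, v, rfl⟩)
  have h2 : A.mulVecLin.quotKerEquivRange.symm ⟨A.mulVecLin v, v, rfl⟩ = Submodule.Quotient.mk v :=
    A.mulVecLin.quotKerEquivRange_symm_apply_image v ⟨v, rfl⟩
  simp only [LinearMap.comp_apply, LinearEquiv.coe_coe, h2] at h1
  exact h1

/-- Two matrices that complete `A₁` to independent columns differ by row operations. -/
theorem exists_mul_add_mul_eq (A₁ : Matrix (Fin m) (Fin m) k) (C C' : Matrix (Fin s) (Fin m) k)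
    (h : StackInjective A₁ C) (h' : StackInjective A₁ C') :
    ∃ (P P' : Matrix (Fin s) (Fin s) k) (Y : Matrix (Fin s) (Fin m) k), P * P' = 1 ∧ P' * P = 1 ∧
      P * C + Y * A₁ = C' := by
  let W := LinearMap.ker A₁.mulVecLin
  have hinj : ∀ {D : Matrix (Fin s) (Fin m) k}, StackInjective A₁ D →
      Function.Injective (D.mulVecLin.domRestrict W) := fun {D} hD => by
    rw [injective_iff_map_eq_zero]
    rintro ⟨v, hv⟩ hv'
    exact Subtype.ext (hD v hv hv')
  obtain ⟨g, hg⟩ := Submodule.exists_linearEquiv_restrict_eq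
    ((LinearEquiv.ofInjective _ (hinj h)).symm.trans (LinearEquiv.ofInjective _ (hinj h')))
  have hgC : ∀ v, A₁.mulVec v = 0 → g (C.mulVec v) = C'.mulVec v := by
    intro v hv
    have h1 := hg (LinearEquiv.ofInjective _ (hinj h) ⟨v, hv⟩)
    rw [LinearEquiv.trans_apply, LinearEquiv.symm_apply_apply] at h1
    exact h1.symm
  let G : Matrix (Fin s) (Fin s) k := LinearMap.toMatrix' g
  have hG : ∀ v, G.mulVec v = g v := fun v => by simp [G]
  obtain ⟨Y, hY⟩ := exists_mul_eq_of_ker_le A₁ (C' - G * C) (fun v hv => by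
    rw [Matrix.sub_mulVec, ← Matrix.mulVec_mulVec, ← hgC v hv, hG, sub_self])
  refine ⟨G, LinearMap.toMatrix' g.symm, Y, ?_, ?_, by rw [hY, add_sub_cancel]⟩
  · rw [← LinearMap.toMatrix'_comp]; simp
  · rw [← LinearMap.toMatrix'_comp]; simp

/-- The normal form depends, up to congruence, only on the congruence class of `A₁`. -/
theorem congruent_blockForm {A₁ A₁' : Matrix (Fin m) (Fin m) k} {C C' : Matrix (Fin s) (Fin m) k}
    (hA : Congruent σ A₁ A₁') (h : StackInjective A₁ C) (h' : StackInjective A₁' C') :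
    Congruent σ (blockForm u A₁ C) (blockForm u A₁' C') := by
  obtain ⟨g, g', hg, hg', rfl⟩ := hA
  set A₁' := (g.map σ).transpose * A₁ * g with hA₁'
  -- Congruence by `g` on the block of `A₁` replaces `C` by `C * g`.
  have hdiag : Congruent σ (blockForm u A₁ C) (blockForm u A₁' (C * g)) := by
    have := congruent_fromBlocks (σ := σ) (pairingBlock k s u m) (Matrix.fromBlocks A₁ 0 C 0)
      (a := 1) (a' := 1) (b := Matrix.fromBlocks g 0 0 1) (b' := Matrix.fromBlocks g' 0 0 1)
      (by simp) (by simp) (by simp [Matrix.fromBlocks_multiply, hg])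
      (by simp [Matrix.fromBlocks_multiply, hg'])
    simpa [blockForm, pairingBlock, Matrix.fromBlocks_multiply, Matrix.fromBlocks_map,
      Matrix.fromBlocks_transpose, ← hA₁'] using this
  have hCg : StackInjective A₁' (C * g) := by
    intro v hv hv'
    have hgt : (g'.map σ).transpose * (g.map σ).transpose = 1 := by
      rw [← Matrix.transpose_mul, ← Matrix.map_mul, hg]
      simp
    have h1 : A₁.mulVec (g.mulVec v) = 0 := by
      have := congrArg (g'.map σ).transpose.mulVec hv
      rwa [hA₁', Matrix.mulVec_mulVec, Matrix.mulVec_zero, Matrix.mul_assoc, ← Matrix.mul_assoc,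
        hgt, Matrix.one_mul, ← Matrix.mulVec_mulVec] at this
    have h2 := h _ h1 (by rwa [← Matrix.mulVec_mulVec] at hv')
    have h3 := congrArg g'.mulVec h2
    simpa [hg'] using h3
  -- Row operations then turn `C * g` into `C'`; they disturb only the columns `D`, `E` that
  -- `congruent_blockForm_of_fromBlocks` clears.
  obtain ⟨P, P', Y, hP, hP', hPY⟩ := exists_mul_add_mul_eq A₁' (C * g) C' hCg h'
  have hrow : Congruent σ (blockForm u A₁' (C * g))
      (Matrix.fromBlocks 0 (pairingBlock k s u m) 0
        (Matrix.fromBlocks A₁' (A₁' * (Y.map σ.symm).transpose) C'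
          (C' * (Y.map σ.symm).transpose))) := by
    have hτ : ∀ {a b : ℕ} (Z : Matrix (Fin a) (Fin b) k),
        (((Z.map σ.symm).transpose).map σ).transpose = Z := fun Z => by
      ext i j
      simp
    have hPP : (P.map σ.symm).transpose * (P'.map σ.symm).transpose = 1 := by
      rw [← Matrix.transpose_mul, ← Matrix.map_mul, hP']
      simp
    have hPP' : (P'.map σ.symm).transpose * (P.map σ.symm).transpose = 1 := by
      rw [← Matrix.transpose_mul, ← Matrix.map_mul, hP]
      simp
    have h1 : ((P'.map σ.symm).map σ.symm) * ((P.map σ.symm).map σ.symm) = 1 := by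
      rw [← Matrix.map_mul, ← Matrix.map_mul, hP']
      simp
    have h2 : ((P.map σ.symm).map σ.symm) * ((P'.map σ.symm).map σ.symm) = 1 := by
      rw [← Matrix.map_mul, ← Matrix.map_mul, hP]
      simp
    have hα : (((P'.map σ.symm).map σ.symm).map σ).transpose = (P'.map σ.symm).transpose := by
      ext i j
      simp
    have := congruent_fromBlocks (σ := σ) (pairingBlock k s u m)
      (Matrix.fromBlocks A₁' 0 (C * g) 0)
      (a := Matrix.fromBlocks ((P'.map σ.symm).map σ.symm) 0 0 1)
      (a' := Matrix.fromBlocks ((P.map σ.symm).map σ.symm) 0 0 1)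
      (b := Matrix.fromBlocks 1 ((Y.map σ.symm).transpose) 0 ((P.map σ.symm).transpose))
      (b' := Matrix.fromBlocks 1 (-((Y.map σ.symm).transpose * (P'.map σ.symm).transpose)) 0
        ((P'.map σ.symm).transpose))
      (by rw [Matrix.fromBlocks_multiply, h1]; simp) (by rw [Matrix.fromBlocks_multiply, h2]; simp)
      (by simp [Matrix.fromBlocks_multiply, hPP])
      (by simp [Matrix.fromBlocks_multiply, hPP', Matrix.mul_assoc])
    simp only [pairingBlock, Matrix.fromBlocks_map, Matrix.fromBlocks_transpose, hτ, hα,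
      Matrix.fromBlocks_multiply] at this
    have hPY' : Y * A₁' + P * (C * g) = C' := by rw [add_comm, hPY]
    simpa [blockForm, pairingBlock, Matrix.fromBlocks_multiply, Matrix.fromBlocks_map,
      Matrix.fromBlocks_transpose, hτ, hα, hPP', hPY'] using this
  exact hdiag.trans (hrow.trans (congruent_blockForm_of_fromBlocks _ _ _ _))

end Block

section Semilinear

variable {σ : k ≃+* k}

/-- The matrix of a Frobenius form in another basis. -/
theorem congruent_gram {ι : Type*} [Fintype ι] [DecidableEq ι] (A : Matrix (Fin n) (Fin n) k)
    (b : Module.Basis ι k (Fin n → k)) :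
    Congruent σ A (Matrix.of fun i j => sesq (σ : k →+* k) A (b i) (b j)) := by
  refine ⟨(Pi.basisFun k (Fin n)).toMatrix b, b.toMatrix (Pi.basisFun k (Fin n)),
    Module.Basis.toMatrix_mul_toMatrix_flip _ _, Module.Basis.toMatrix_mul_toMatrix_flip _ _, ?_⟩
  ext i j
  rw [Matrix.of_apply, sesq_apply, Matrix.dotProduct_mulVec]
  rfl

theorem exists_inf_eq_bot_sup_eq {V : Type*} [AddCommGroup V] [Module k V] {K R : Submodule k V}
    (h : K ≤ R) : ∃ Q : Submodule k V, Q ⊓ K = ⊥ ∧ Q ⊔ K = R := by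
  obtain ⟨K', hK'⟩ := Submodule.exists_isCompl K
  refine ⟨R ⊓ K', ?_, ?_⟩
  · rw [inf_assoc, inf_comm K', hK'.inf_eq_bot, inf_bot_eq]
  · rw [sup_comm, inf_comm, ← sup_inf_assoc_of_le K' h, hK'.sup_eq_top, top_inf_eq]

/-- The intersection of the left and the right kernel of a Frobenius form. Up to a linear change of
coordinates its dimension is the number of variables that do not occur in the form. -/
def radical (σ : k ≃+* k) (A : Matrix (Fin n) (Fin n) k) : Submodule k (Fin n → k) :=
  LinearMap.ker A.mulVecLin ⊓ LinearMap.ker (sesq (σ : k →+* k) A)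

theorem sesq_eq_zero_of_mulVec {A : Matrix (Fin n) (Fin n) k} {y : Fin n → k}
    (hy : A.mulVec y = 0) (x : Fin n → k) : sesq (σ : k →+* k) A x y = 0 := by
  rw [sesq_apply, hy, dotProduct_zero]

theorem mulVec_eq_zero_of_sesq {A : Matrix (Fin n) (Fin n) k} {y : Fin n → k}
    (hy : ∀ x, sesq (σ : k →+* k) A x y = 0) : A.mulVec y = 0 := by
  funext i
  have := hy (Pi.single i 1)
  rw [sesq_apply] at this
  have h1 : (fun j => (σ : k →+* k) ((Pi.single i 1 : Fin n → k) j)) = Pi.single i 1 := by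
    funext j
    by_cases h : j = i
    · subst h; simp
    · simp [h]
  rw [h1] at this
  simpa using this

/-- Vectors independent modulo the left kernel give independent functionals. -/
theorem surjective_pi_sesq {A : Matrix (Fin n) (Fin n) k} {s : ℕ}
    (r : Fin s → Fin n → k)
    (hr : ∀ a : Fin s → k, sesq (σ : k →+* k) A (∑ i, a i • r i) = 0 → a = 0) :
    Function.Surjective (LinearMap.pi fun i => sesq (σ : k →+* k) A (r i)) := by
  rw [← LinearMap.range_eq_top]
  by_contra hne
  obtain ⟨f, hf0, hf⟩ := Submodule.exists_le_ker_of_lt_top _ (lt_top_iff_ne_top.2 hne)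
  let a : Fin s → k := fun i => f (Pi.single i 1)
  have hfa : ∀ x, f x = ∑ i, a i * x i := fun x => by
    conv_lhs => rw [pi_eq_sum_univ' x]
    simp [a, mul_comm]
  have ha : (fun i => σ.symm (a i)) = 0 := hr _ (by
    refine LinearMap.ext fun y => ?_
    have h1 := hf ⟨y, rfl⟩
    rw [LinearMap.mem_ker, hfa] at h1
    simpa using h1)
  refine hf0 (LinearMap.ext fun x => ?_)
  rw [hfa, LinearMap.zero_apply]
  exact Finset.sum_eq_zero fun i _ => by
    have := congrFun ha i
    simp only [Pi.zero_apply, map_eq_zero] at this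
    rw [this, zero_mul]

/-- Every Frobenius form is congruent to a `blockForm`. The variables `r`, `z` come from the right
kernel `R`, with `z` from the radical; `h` spans a complement of `R` in its annihilator, and `c` is
dual to `r`. -/
theorem exists_congruent_blockForm (σ : k ≃+* k) (A : Matrix (Fin n) (Fin n) k) :
    ∃ (s u m : ℕ) (A₁ : Matrix (Fin m) (Fin m) k) (C : Matrix (Fin s) (Fin m) k),
      StackInjective A₁ C ∧ s + u = Module.finrank k (LinearMap.ker A.mulVecLin) ∧
      u = Module.finrank k (radical σ A) ∧ s + u + (m + s) = n ∧
      Congruent σ A (blockForm u A₁ C) := by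
  set B := sesq (σ : k →+* k) A with hB
  set R := LinearMap.ker A.mulVecLin with hR
  set K := radical σ A with hK
  have hKR : K ≤ R := inf_le_left
  obtain ⟨R₀, hR₀K, hR₀R⟩ := exists_inf_eq_bot_sup_eq hKR
  let s := Module.finrank k R₀
  let u := Module.finrank k K
  let r : Fin s → Fin n → k := fun i => Module.finBasis k R₀ i
  let z : Fin u → Fin n → k := fun i => Module.finBasis k K i
  have hspan : ∀ W : Submodule k (Fin n → k),
      Submodule.span k (Set.range fun i => (Module.finBasis k W i : Fin n → k)) = W := by
    intro W
    have := congrArg (Submodule.map W.subtype) (Module.finBasis k W).span_eq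
    rw [Submodule.map_span, Submodule.map_subtype_top, ← Set.range_comp] at this
    exact this
  have hli : ∀ W : Submodule k (Fin n → k),
      LinearIndependent k fun i => (Module.finBasis k W i : Fin n → k) := fun W =>
    (Module.finBasis k W).linearIndependent.map' W.subtype W.ker_subtype
  have hrR : ∀ i, r i ∈ R := fun i => hR₀R ▸ Submodule.mem_sup_left (Module.finBasis k R₀ i).2
  have hzK : ∀ i, z i ∈ K := fun i => (Module.finBasis k K i).2
  have hzR : ∀ i, z i ∈ R := fun i => hKR (hzK i)
  have hBR : ∀ x, ∀ y ∈ R, B x y = 0 := fun x y hy => sesq_eq_zero_of_mulVec hy x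
  have hBz : ∀ i y, B (z i) y = 0 := fun i y => by
    have := (hzK i).2
    rw [LinearMap.mem_ker.1 this, LinearMap.zero_apply]
  let Φ := LinearMap.pi fun i => B (r i)
  have hΦ : Function.Surjective Φ := surjective_pi_sesq r (fun a ha => by
    have h1 : ∑ i, a i • r i ∈ R₀ :=
      Submodule.sum_mem _ fun i _ => Submodule.smul_mem _ _ (Module.finBasis k R₀ i).2
    have h2 : ∑ i, a i • r i ∈ K :=
      ⟨Submodule.sum_mem _ fun i _ => Submodule.smul_mem _ _ (hrR i), ha⟩
    have h3 : ∑ i, a i • r i = 0 := by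
      rw [← Submodule.mem_bot k, ← hR₀K]
      exact ⟨h1, h2⟩
    exact funext (Fintype.linearIndependent_iff.1 (hli R₀) a h3))
  choose c hc using fun j : Fin s => hΦ (Pi.single j 1)
  have hRΦ : R ≤ LinearMap.ker Φ := fun y hy => by
    rw [LinearMap.mem_ker]
    funext i
    exact hBR _ y hy
  obtain ⟨Q, hQR, hQΦ⟩ := exists_inf_eq_bot_sup_eq hRΦ
  let m := Module.finrank k Q
  let h : Fin m → Fin n → k := fun i => Module.finBasis k Q i
  have hhΦ : ∀ i, Φ (h i) = 0 := fun i => by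
    have : h i ∈ LinearMap.ker Φ := hQΦ ▸ Submodule.mem_sup_left (Module.finBasis k Q i).2
    exact this
  have hΦc : ∀ a : Fin s → k, Φ (∑ i, a i • c i) = a := fun a => by
    simp only [map_sum, map_smul, hc]
    funext j
    simp [Pi.single_apply]
  have hcker : ∀ y ∈ Submodule.span k (Set.range c), Φ y = 0 → y = 0 := by
    intro y hy h0
    obtain ⟨a, rfl⟩ := (Submodule.mem_span_range_iff_exists_fun k).1 hy
    rw [hΦc] at h0
    simp [h0]
  have hcli : LinearIndependent k c := Fintype.linearIndependent_iff.2 fun a ha => by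
    have := hΦc a
    rw [ha, map_zero] at this
    exact fun i => (congrFun this i).symm
  have hrz : LinearIndependent k (Sum.elim r z) := (hli R₀).sum_type (hli K) (by
    rw [hspan, hspan, disjoint_iff, hR₀K])
  have hrzspan : Submodule.span k (Set.range (Sum.elim r z)) = R := by
    rw [Set.Sum.elim_range, Submodule.span_union, hspan, hspan, hR₀R]
  have hhc : LinearIndependent k (Sum.elim h c) := (hli Q).sum_type hcli (by
    rw [hspan, Submodule.disjoint_def]
    intro y hy hyc
    have : y ∈ LinearMap.ker Φ := hQΦ ▸ Submodule.mem_sup_left hy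
    exact hcker y hyc this)
  have hhcspan : Submodule.span k (Set.range (Sum.elim h c)) =
      Q ⊔ Submodule.span k (Set.range c) := by
    rw [Set.Sum.elim_range, Submodule.span_union, hspan]
  have hall : LinearIndependent k (Sum.elim (Sum.elim r z) (Sum.elim h c)) := hrz.sum_type hhc (by
    rw [hrzspan, hhcspan, Submodule.disjoint_def]
    intro x hx hx'
    obtain ⟨y, hy, w, hw, rfl⟩ := Submodule.mem_sup.1 hx'
    have hyΦ : Φ y = 0 := (hQΦ ▸ Submodule.mem_sup_left hy : y ∈ LinearMap.ker Φ)
    have h1 : Φ (y + w) = 0 := hRΦ hx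
    rw [map_add, hyΦ, zero_add] at h1
    have hw0 := hcker w hw h1
    rw [hw0, add_zero] at hx ⊢
    rw [← Submodule.mem_bot k, ← hQR]
    exact ⟨hy, hx⟩)
  have htop : ⊤ ≤ Submodule.span k (Set.range (Sum.elim (Sum.elim r z) (Sum.elim h c))) := by
    intro v _
    rw [Set.Sum.elim_range, Submodule.span_union, hrzspan, hhcspan, ← sup_assoc, sup_comm R, hQΦ]
    have h1 : v - ∑ i, Φ v i • c i ∈ LinearMap.ker Φ := by
      rw [LinearMap.mem_ker, map_sub, hΦc, sub_self]
    rw [← sub_add_cancel v (∑ i, Φ v i • c i)]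
    exact Submodule.add_mem_sup h1
      (Submodule.sum_mem _ fun i _ => Submodule.smul_mem _ _ (Submodule.subset_span ⟨i, rfl⟩))
  let b := Module.Basis.mk hall htop
  have hb : ∀ i, b i = Sum.elim (Sum.elim r z) (Sum.elim h c) i := fun i =>
    congrFun (Module.Basis.coe_mk hall htop) i
  let A₁ : Matrix (Fin m) (Fin m) k := Matrix.of fun i j => B (h i) (h j)
  let C : Matrix (Fin s) (Fin m) k := Matrix.of fun i j => B (c i) (h j)
  refine ⟨s, u, m, A₁, C, ?_, ?_, rfl, ?_, ?_⟩
  · intro v hv hv'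
    have hsum : ∀ x, B x (∑ j, v j • h j) = ∑ j, B x (h j) * v j := fun x => by
      simp [mul_comm]
    have h0 : ∀ i, B (b i) (∑ j, v j • h j) = 0 := by
      intro i
      rw [hb]
      rcases i with (i | i) | (i | i)
      · have h1 : Φ (∑ j, v j • h j) = 0 := by simp [hhΦ]
        exact congrFun h1 i
      · exact hBz i _
      · rw [hsum]; exact congrFun hv i
      · rw [hsum]; exact congrFun hv' i
    have h1 : ∀ x, B x (∑ j, v j • h j) = 0 := by
      intro x
      have : LinearMap.flip B (∑ j, v j • h j) = 0 := b.ext fun i => h0 i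
      exact congr($this x)
    have h2 : ∑ j, v j • h j = 0 := by
      rw [← Submodule.mem_bot k, ← hQR]
      exact ⟨Submodule.sum_mem _ fun i _ => Submodule.smul_mem _ _ (Module.finBasis k Q i).2,
        mulVec_eq_zero_of_sesq h1⟩
    exact funext (Fintype.linearIndependent_iff.1 (hli Q) v h2)
  · have := finrank_span_eq_card hrz
    rw [hrzspan] at this
    rw [this]
    simp
  · have := Module.finrank_eq_card_basis b
    simp at this
    exact this.symm
  · refine Congruent.trans ?_ (congruent_blockForm_of_fromBlocks A₁
      (Matrix.of fun i j => B (h i) (c j)) C (Matrix.of fun i j => B (c i) (c j)))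
    convert congruent_gram (σ := σ) A b using 1
    ext i j
    rw [Matrix.of_apply, hb, hb]
    rcases i with (i | i) | (i | i) <;> rcases j with (j | j) | (j | j) <;>
      simp [← hB, pairingBlock, hBR _ _ (hrR _), hBR _ _ (hzR _), hBz, A₁, C]
    · exact (congrFun (hhΦ j) i).symm
    · rw [show B (r i) (c j) = Φ (c j) i from rfl, hc, Pi.single_apply, Matrix.one_apply]

end Semilinear

/-! ### Counting congruence classes -/

/-- The number of partitions of integers at most `n` into parts of size at most `t`. It bounds the
number of congruence classes of `n × n` matrices of corank at most `t`. -/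
def partitionCount : ℕ → ℕ → ℕ
  | _, 0 => 1
  | n, t + 1 => partitionCount n t +
      if t + 1 ≤ n then partitionCount (n - (t + 1)) (t + 1) else 0
termination_by n t => n + t

theorem partitionCount_zero (n : ℕ) : partitionCount n 0 = 1 := by rw [partitionCount]

theorem partitionCount_succ (n t : ℕ) : partitionCount n (t + 1) = partitionCount n t +
    if t + 1 ≤ n then partitionCount (n - (t + 1)) (t + 1) else 0 := by rw [partitionCount]

theorem partitionCount_mono (t : ℕ) : Monotone fun n => partitionCount n t := by
  induction t with
  | zero => intro a b _; simp [partitionCount_zero]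
  | succ t ih =>
    intro a b hab
    induction b using Nat.strong_induction_on generalizing a with
    | _ b ihb =>
      simp only
      rw [partitionCount_succ a, partitionCount_succ b]
      refine Nat.add_le_add (ih hab) ?_
      split_ifs with h1 h2
      · exact ihb _ (by lia) (Nat.sub_le_sub_right hab _)
      · lia
      · exact Nat.zero_le _
      · exact le_rfl

/-- Partitions sorted by their largest part. -/
theorem sum_partitionCount_sub (n t : ℕ) :
    ∑ s ∈ Finset.range (t + 1), (if s ≤ n then partitionCount (n - s) s else 0) =
      partitionCount n t := by
  induction t with
  | zero => simp [partitionCount_zero]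
  | succ t ih => rw [Finset.sum_range_succ, ih, partitionCount_succ n]

/-- The recursion of `partitionCount` splits the sum for `n + 2` into the sum for `n` and a part
bounded by the sum for `n + 1`. -/
theorem sum_partitionCount_le_fib (n : ℕ) :
    ∑ s ∈ Finset.range (n / 2 + 1), partitionCount (n - 2 * s) s ≤ Nat.fib (n + 1) := by
  induction n using Nat.twoStepInduction with
  | zero => simp [partitionCount_zero]
  | one => simp [partitionCount_zero]
  | more n ih₀ ih₁ =>
    rw [Nat.fib_add_two]
    refine le_trans ?_ (Nat.add_le_add ih₀ ih₁)
    rw [show (n + 2) / 2 + 1 = (n / 2 + 1) + 1 by lia, Finset.sum_range_succ' _ (n / 2 + 1)]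
    have h1 : ∀ s, partitionCount (n + 2 - 2 * (s + 1)) (s + 1) = partitionCount (n - 2 * s) s +
        if s + 1 ≤ n - 2 * s then partitionCount (n - 2 * s - (s + 1)) (s + 1) else 0 := by
      intro s
      rw [show n + 2 - 2 * (s + 1) = n - 2 * s by lia, partitionCount_succ]
    simp_rw [h1]
    rw [Finset.sum_add_distrib, add_assoc, Finset.sum_range_succ' _ ((n + 1) / 2)]
    simp only [mul_zero, Nat.sub_zero, partitionCount_zero]
    refine Nat.add_le_add_left (Nat.add_le_add_right ?_ 1) _
    calc ∑ s ∈ Finset.range (n / 2 + 1),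
          (if s + 1 ≤ n - 2 * s then partitionCount (n - 2 * s - (s + 1)) (s + 1) else 0)
        ≤ ∑ s ∈ Finset.range ((n + 1) / 2),
          (if s + 1 ≤ n - 2 * s then partitionCount (n - 2 * s - (s + 1)) (s + 1) else 0) := by
          refine Finset.sum_le_sum_of_ne_zero fun s _ hs => ?_
          have : s + 1 ≤ n - 2 * s := by
            by_contra h
            exact hs (if_neg h)
          rw [Finset.mem_range]
          lia
      _ ≤ _ := by
          refine Finset.sum_le_sum fun s _ => ?_
          split_ifs
          · exact partitionCount_mono (s + 1) (by lia)
          · exact Nat.zero_le _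

section Reps

variable {σ : k ≃+* k}

theorem finrank_ker_le_of_stackInjective {s m : ℕ} {A₁ : Matrix (Fin m) (Fin m) k}
    {C : Matrix (Fin s) (Fin m) k} (h : StackInjective A₁ C) :
    Module.finrank k (LinearMap.ker A₁.mulVecLin) ≤ s := by
  have hinj : Function.Injective (C.mulVecLin.domRestrict (LinearMap.ker A₁.mulVecLin)) := by
    rw [injective_iff_map_eq_zero]
    rintro ⟨v, hv⟩ hv'
    exact Subtype.ext (h v hv hv')
  simpa using LinearMap.finrank_le_finrank_of_injective hinj

/-- Representatives for the matrices `A₁` of corank at most `s` yield representatives for the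
matrices with normal form of type `(s, u)`. -/
theorem exists_representatives_of_type {s u m c : ℕ} (hn : s + u + (m + s) = n)
    (H : ∃ S : Finset (Matrix (Fin m) (Fin m) k), S.card ≤ c ∧
      ∀ A : Matrix (Fin m) (Fin m) k, Module.finrank k (LinearMap.ker A.mulVecLin) ≤ s →
        ∃ B ∈ S, Congruent σ B A) :
    ∃ S : Finset (Matrix (Fin n) (Fin n) k), S.card ≤ c ∧
      ∀ A : Matrix (Fin n) (Fin n) k, Module.finrank k (LinearMap.ker A.mulVecLin) = s + u →
        Module.finrank k (radical σ A) = u → ∃ B ∈ S, Congruent σ B A := by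
  classical
  obtain ⟨S, hS, hrep⟩ := H
  let P : Matrix (Fin m) (Fin m) k → Matrix (Fin n) (Fin n) k → Prop := fun B A =>
    ∃ A₁ : Matrix (Fin m) (Fin m) k, ∃ C : Matrix (Fin s) (Fin m) k,
      Congruent σ B A₁ ∧ StackInjective A₁ C ∧ Congruent σ A (blockForm u A₁ C)
  refine ⟨S.image fun B => if h : ∃ A, P B A then h.choose else 0,
    Finset.card_image_le.trans hS, fun A hA hA' => ?_⟩
  obtain ⟨s', u', m', A₁, C, hC, hs, hu, hm, hcong⟩ := exists_congruent_blockForm σ A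
  obtain rfl : u' = u := by lia
  obtain rfl : s' = s := by lia
  obtain rfl : m' = m := by lia
  obtain ⟨B, hB, hBA⟩ := hrep A₁ (finrank_ker_le_of_stackInjective hC)
  have hex : ∃ A, P B A := ⟨A, A₁, C, hBA, hC, hcong⟩
  refine ⟨_, Finset.mem_image_of_mem _ hB, ?_⟩
  rw [dif_pos hex]
  obtain ⟨A₁', C', hBA', hC', hcong'⟩ := hex.choose_spec
  exact hcong'.trans ((congruent_blockForm (hBA'.symm.trans hBA) hC' hC).trans hcong.symm)

theorem exists_representatives_biUnion {ι α : Type*} (I : Finset ι) (c : ι → ℕ)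
    (p : ι → α → Prop) (r : α → α → Prop)
    (H : ∀ i ∈ I, ∃ S : Finset α, S.card ≤ c i ∧ ∀ a, p i a → ∃ b ∈ S, r b a) :
    ∃ S : Finset α, S.card ≤ ∑ i ∈ I, c i ∧ ∀ a, (∃ i ∈ I, p i a) → ∃ b ∈ S, r b a := by
  classical
  choose! S hS hr using H
  refine ⟨I.biUnion S, Finset.card_biUnion_le.trans (Finset.sum_le_sum hS), ?_⟩
  rintro a ⟨i, hi, ha⟩
  obtain ⟨b, hb, hba⟩ := hr i hi a ha
  exact ⟨b, Finset.mem_biUnion.2 ⟨i, hi, hb⟩, hba⟩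

/-- If invertible matrices are congruent to `1`, then `n × n` matrices of corank at most `t` fall
into at most `partitionCount n t` congruence classes. Those of corank `t` are reduced to matrices of
size `n - t - s` and corank at most `s`, where `t - s` is the dimension of the radical, and the
counts add up by `sum_partitionCount_sub`. -/
theorem exists_representatives (hσ : ∀ (n : ℕ) (A : Matrix (Fin n) (Fin n) k), IsUnit A.det →
      Congruent σ A (1 : Matrix (Fin n) (Fin n) k)) (n t : ℕ) :
    ∃ S : Finset (Matrix (Fin n) (Fin n) k), S.card ≤ partitionCount n t ∧
      ∀ A : Matrix (Fin n) (Fin n) k, Module.finrank k (LinearMap.ker A.mulVecLin) ≤ t →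
        ∃ B ∈ S, Congruent σ B A := by
  induction n using Nat.strong_induction_on generalizing t with
  | _ n ihn =>
  induction t with
  | zero =>
    refine ⟨{1}, by simp [partitionCount_zero], fun A hA => ⟨1, by simp, (hσ n A ?_).symm⟩⟩
    have hbot := Submodule.finrank_eq_zero.1 (Nat.le_zero.1 hA)
    rw [← Matrix.isUnit_iff_isUnit_det, ← Matrix.mulVec_injective_iff_isUnit]
    exact LinearMap.ker_eq_bot.1 hbot
  | succ t iht =>
    obtain ⟨S, hS, hrep⟩ := iht
    obtain ⟨S', hS', hrep'⟩ := exists_representatives_biUnion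
      ((Finset.range (t + 1 + 1)).filter fun s => t + 1 + s ≤ n)
      (fun s => partitionCount (n - (t + 1) - s) s)
      (fun s (A : Matrix (Fin n) (Fin n) k) =>
        Module.finrank k (LinearMap.ker A.mulVecLin) = s + (t + 1 - s) ∧
          Module.finrank k (radical σ A) = t + 1 - s) (Congruent σ) (fun s hs => by
        rw [Finset.mem_filter, Finset.mem_range] at hs
        obtain ⟨S, hS, hrep⟩ := exists_representatives_of_type (n := n) (σ := σ) (s := s)
          (u := t + 1 - s) (m := n - (t + 1) - s) (by lia) (ihn _ (by lia) s)
        exact ⟨S, hS, fun A hA => hrep A hA.1 hA.2⟩)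
    classical
    refine ⟨S ∪ S', (Finset.card_union_le _ _).trans ?_, fun A hA => ?_⟩
    · rw [partitionCount_succ]
      refine Nat.add_le_add hS (hS'.trans ?_)
      rw [Finset.sum_filter]
      split_ifs with h
      · rw [← sum_partitionCount_sub (n - (t + 1)) (t + 1)]
        refine Finset.sum_le_sum fun s _ => ?_
        split_ifs <;> first | exact le_rfl | lia
      · rw [Finset.sum_eq_zero fun s _ => if_neg (by lia)]
    · rcases Nat.lt_or_ge (Module.finrank k (LinearMap.ker A.mulVecLin)) (t + 1) with h | h
      · obtain ⟨B, hB, hBA⟩ := hrep A (by lia)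
        exact ⟨B, Finset.mem_union_left _ hB, hBA⟩
      · obtain ⟨s, u, m, _, _, -, hs, hu, hm, -⟩ := exists_congruent_blockForm σ A
        obtain ⟨B, hB, hBA⟩ := hrep' A ⟨s, by
          rw [Finset.mem_filter, Finset.mem_range]
          lia, by lia, by lia⟩
        exact ⟨B, Finset.mem_union_right _ hB, hBA⟩

/-- Matrices whose radical has codimension `n` fall into at most `Nat.fib (n + 1)` congruence
classes. -/
theorem exists_representatives_radical (hσ : ∀ (n : ℕ) (A : Matrix (Fin n) (Fin n) k),
      IsUnit A.det → Congruent σ A (1 : Matrix (Fin n) (Fin n) k)) (N n : ℕ) :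
    ∃ S : Finset (Matrix (Fin N) (Fin N) k), S.card ≤ Nat.fib (n + 1) ∧
      ∀ A : Matrix (Fin N) (Fin N) k, Module.finrank k (radical σ A) + n = N →
        ∃ B ∈ S, Congruent σ B A := by
  by_cases hnN : n ≤ N
  · obtain ⟨S, hS, hrep⟩ := exists_representatives_biUnion (Finset.range (n / 2 + 1))
      (fun s => partitionCount (n - 2 * s) s)
      (fun s (A : Matrix (Fin N) (Fin N) k) =>
        Module.finrank k (LinearMap.ker A.mulVecLin) = s + (N - n) ∧
          Module.finrank k (radical σ A) = N - n) (Congruent σ) (fun s hs => by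
        rw [Finset.mem_range] at hs
        obtain ⟨S, hS, hrep⟩ := exists_representatives_of_type (n := N) (σ := σ) (s := s)
          (u := N - n) (m := n - 2 * s) (by lia) (exists_representatives hσ _ s)
        exact ⟨S, hS, fun A hA => hrep A hA.1 hA.2⟩)
    refine ⟨S, hS.trans (sum_partitionCount_le_fib n), fun A hA => hrep A ?_⟩
    obtain ⟨s, u, m, _, _, -, hs, hu, hm, -⟩ := exists_congruent_blockForm σ A
    exact ⟨s, by rw [Finset.mem_range]; lia, by lia, by lia⟩
  · exact ⟨∅, by simp, fun A hA => by lia⟩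

end Reps

/-! ### Embedding dimension -/

theorem frobForm_eq_sum_monomial (q : ℕ) (A : Matrix (Fin n) (Fin n) k) :
    frobForm q A = ∑ i, ∑ j, monomial (Finsupp.single i q + Finsupp.single j 1) (A i j) := by
  refine Finset.sum_congr rfl fun i _ => Finset.sum_congr rfl fun j _ => ?_
  rw [X_pow_eq_monomial, X, mul_assoc, monomial_mul, C_mul_monomial]
  simp

/-- The exponents `q eᵢ + eⱼ` determine `i` and `j` because `q > 1`. -/
theorem single_add_single_eq_iff {q : ℕ} (hq : 1 < q) {i j a b : Fin n} :
    Finsupp.single a q + Finsupp.single b 1 = Finsupp.single i q + Finsupp.single j 1 ↔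
      a = i ∧ b = j := by
  refine ⟨fun h => ?_, by rintro ⟨rfl, rfl⟩; rfl⟩
  have hai : a = i := by
    by_contra hne
    have h1 := DFunLike.congr_fun h a
    have h2 : (Finsupp.single j 1 : Fin n →₀ ℕ) a ≤ 1 := by
      rw [Finsupp.single_apply]; split_ifs <;> simp
    simp only [Finsupp.add_apply, Finsupp.single_eq_same, Finsupp.single_eq_of_ne hne] at h1
    lia
  subst hai
  exact ⟨rfl, Finsupp.single_left_injective one_ne_zero (add_left_cancel h)⟩

theorem coeff_frobForm {q : ℕ} (hq : 1 < q) (A : Matrix (Fin n) (Fin n) k) (i j : Fin n) :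
    coeff (Finsupp.single i q + Finsupp.single j 1) (frobForm q A) = A i j := by
  classical
  simp only [frobForm_eq_sum_monomial, coeff_sum, coeff_monomial, single_add_single_eq_iff hq]
  rw [Finset.sum_eq_single i (fun a _ ha => by simp [ha]) (by simp),
    Finset.sum_eq_single j (fun b _ hb => by simp [hb]) (by simp)]
  simp

theorem notMem_vars_frobForm {q : ℕ} {A : Matrix (Fin n) (Fin n) k} {i : Fin n}
    (h : ∀ j, A i j = 0 ∧ A j i = 0) : i ∉ (frobForm q A).vars := by
  classical
  intro hi
  obtain ⟨m, hm, him⟩ := (mem_vars_iff_mem_support i).1 hi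
  rw [frobForm_eq_sum_monomial] at hm
  obtain ⟨a, -, ha⟩ := Finset.mem_biUnion.1 (support_sum hm)
  obtain ⟨b, -, hb⟩ := Finset.mem_biUnion.1 (support_sum ha)
  rw [mem_support_iff, coeff_monomial] at hb
  obtain ⟨rfl, hA⟩ : Finsupp.single a q + Finsupp.single b 1 = m ∧ A a b ≠ 0 := by
    simpa using hb
  have hia : i ≠ a := by rintro rfl; exact hA (h b).1
  have hib : i ≠ b := by rintro rfl; exact hA (h a).2
  simp [Finsupp.single_eq_of_ne hia, Finsupp.single_eq_of_ne hib] at him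

theorem eq_zero_of_notMem_vars_frobForm {q : ℕ} (hq : 1 < q) {A : Matrix (Fin n) (Fin n) k}
    {i : Fin n} (h : i ∉ (frobForm q A).vars) (j : Fin n) : A i j = 0 ∧ A j i = 0 := by
  constructor
  · by_contra hA
    refine h ((mem_vars_iff_mem_support i).2 ⟨Finsupp.single i q + Finsupp.single j 1, ?_, ?_⟩)
    · rwa [mem_support_iff, coeff_frobForm hq]
    · simp; lia
  · by_contra hA
    refine h ((mem_vars_iff_mem_support i).2 ⟨Finsupp.single j q + Finsupp.single i 1, ?_, ?_⟩)
    · rwa [mem_support_iff, coeff_frobForm hq]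
    · simp

theorem sesq_congr {σ : k ≃+* k} (g A : Matrix (Fin n) (Fin n) k) (x y : Fin n → k) :
    sesq (σ : k →+* k) ((g.map σ).transpose * A * g) x y =
      sesq (σ : k →+* k) A (g.mulVec x) (g.mulVec y) := by
  have h : (fun i => (σ : k →+* k) (g.mulVec x i)) =
      (g.map σ).mulVec fun i => (σ : k →+* k) (x i) := by
    funext i
    simp [Matrix.mulVec, dotProduct]
  rw [sesq_apply, sesq_apply, h, ← Matrix.mulVec_mulVec, ← Matrix.mulVec_mulVec,
    Matrix.dotProduct_mulVec, Matrix.vecMul_transpose]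

theorem finrank_radical_congr_le {σ : k ≃+* k} (g : Matrix.GeneralLinearGroup (Fin n) k)
    (A : Matrix (Fin n) (Fin n) k) :
    Module.finrank k (radical σ ((g.val.map σ).transpose * A * g.val)) ≤
      Module.finrank k (radical σ A) := by
  have hinj : Function.Injective g.val.mulVecLin :=
    Matrix.mulVec_injective_of_isUnit g.isUnit
  have hsurj : ∀ y, ∃ x, g.val.mulVec x = y := fun y => ⟨g⁻¹.val.mulVec y, by
    rw [Matrix.mulVec_mulVec, ← Units.val_mul, mul_inv_cancel, Units.val_one, Matrix.one_mulVec]⟩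
  rw [(Submodule.equivMapOfInjective _ hinj _).finrank_eq]
  refine Submodule.finrank_mono ?_
  rintro _ ⟨x, ⟨hx, hx'⟩, rfl⟩
  refine ⟨mulVec_eq_zero_of_sesq (σ := σ) fun y => ?_, LinearMap.ext fun y => ?_⟩
  · obtain ⟨y, rfl⟩ := hsurj y
    exact (sesq_congr g.val A y x).symm.trans (sesq_eq_zero_of_mulVec hx y)
  · obtain ⟨y, rfl⟩ := hsurj y
    exact (sesq_congr g.val A x y).symm.trans congr($hx' y)

/-- The embedding dimension is the codimension of the radical. The normal form `blockForm` omits as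
many variables as the radical has dimensions; conversely, the basis vectors of variables that do
not occur lie in the radical, and the dimension of the radical is invariant. -/
theorem embDim_frobForm_add_finrank_radical {p : ℕ} [Fact p.Prime] [CharP k p] [PerfectRing k p]
    {e : ℕ} (he : e ≠ 0) (A : Matrix (Fin n) (Fin n) k) :
    embDim (frobForm (p ^ e) A) + Module.finrank k (radical (frob k p e) A) = n := by
  classical
  have hq : 1 < p ^ e := Nat.one_lt_pow he (Fact.out : p.Prime).one_lt
  refine le_antisymm ?_ ?_
  · obtain ⟨s, u, m, A₁, C, -, -, hu, hm, hcong⟩ := exists_congruent_blockForm (frob k p e) A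
    let ε : Fin n ≃ (Fin s ⊕ Fin u) ⊕ (Fin m ⊕ Fin s) := Fintype.equivOfCardEq (by simp; lia)
    obtain ⟨g, h, h1, h2, hg⟩ := hcong.trans (Congruent.submatrix_equiv (blockForm u A₁ C) ε)
    let G : Matrix.GeneralLinearGroup (Fin n) k := ⟨g, h, h1, h2⟩
    have hG : linSubst G.val (frobForm (p ^ e) A) =
        frobForm (p ^ e) ((blockForm u A₁ C).submatrix ε ε) := by
      rw [linSubst_frobForm, ← hg]
    have hle : embDim (frobForm (p ^ e) A) ≤
        (frobForm (p ^ e) ((blockForm u A₁ C).submatrix ε ε)).vars.card := by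
      rw [← hG]
      exact Nat.sInf_le ⟨G, rfl⟩
    -- The coordinates of the radical block do not occur.
    let T : Finset (Fin n) := Finset.univ.image fun i : Fin u => ε.symm (Sum.inl (Sum.inr i))
    have hT : T.card = u := by
      rw [Finset.card_image_of_injective _ fun i j hij => by simpa using hij, Finset.card_univ,
        Fintype.card_fin]
    have hdisj : Disjoint (frobForm (p ^ e) ((blockForm u A₁ C).submatrix ε ε)).vars T := by
      rw [Finset.disjoint_right]
      intro x hx
      obtain ⟨i, -, rfl⟩ := Finset.mem_image.1 hx
      refine notMem_vars_frobForm fun j => ?_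
      simp only [Matrix.submatrix_apply, Equiv.apply_symm_apply]
      constructor
      · rcases ε j with (j | j) | (j | j) <;> simp [blockForm, pairingBlock]
      · rcases ε j with (j | j) | (j | j) <;> simp [blockForm, pairingBlock]
    have h3 := Finset.card_le_univ
      ((frobForm (p ^ e) ((blockForm u A₁ C).submatrix ε ε)).vars ∪ T)
    rw [Finset.card_union_of_disjoint hdisj, hT, Fintype.card_fin] at h3
    lia
  · obtain ⟨g, hg⟩ := Nat.sInf_mem (Set.range_nonempty fun A' :
      Matrix.GeneralLinearGroup (Fin n) k => (linSubst A'.val (frobForm (p ^ e) A)).vars.card)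
    rw [embDim, ← hg]
    simp only
    rw [linSubst_frobForm]
    set A' := (g.val.map (frob k p e)).transpose * A * g.val with hA'
    have h1 : (frobForm (p ^ e) A').varsᶜ.card ≤ Module.finrank k (radical (frob k p e) A') := by
      have hli : LinearIndependent k fun i : ((frobForm (p ^ e) A').varsᶜ : Finset (Fin n)) =>
          (Pi.single i.1 1 : Fin n → k) := by
        have := (Pi.basisFun k (Fin n)).linearIndependent.comp
          (fun i : ((frobForm (p ^ e) A').varsᶜ : Finset (Fin n)) => i.1) Subtype.val_injective
        convert this using 2 with i
        simp
      have h2 := finrank_span_eq_card hli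
      rw [Fintype.card_coe] at h2
      rw [← h2]
      refine Submodule.finrank_mono (Submodule.span_le.2 ?_)
      rintro _ ⟨i, rfl⟩
      have hi := eq_zero_of_notMem_vars_frobForm hq (Finset.mem_compl.1 i.2)
      refine ⟨?_, LinearMap.ext fun y => ?_⟩
      · change A'.mulVec (Pi.single i.1 1) = 0
        funext j
        simp [(hi j).2]
      · rw [sesq_apply, LinearMap.zero_apply]
        refine Finset.sum_eq_zero fun j _ => ?_
        by_cases hj : j = i.1
        · subst hj
          have h0 : A'.mulVec y i.1 = 0 := by
            change ∑ l, A' i.1 l * y l = 0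
            exact Finset.sum_eq_zero fun l _ => by rw [(hi l).1, zero_mul]
          rw [h0, mul_zero]
        · simp [hj]
    have h2 := finrank_radical_congr_le (σ := frob k p e) g A
    rw [← hA'] at h2
    rw [Finset.card_compl, Fintype.card_fin] at h1
    lia

/-! ### The singular locus of a Frobenius form -/

theorem pderiv_frobForm {p : ℕ} [CharP k p] {e : ℕ} (he : e ≠ 0)
    (A : Matrix (Fin n) (Fin n) k) (j : Fin n) :
    pderiv j (frobForm (p ^ e) A) = ∑ i, C (A i j) * X i ^ p ^ e := by
  have hpow : ∀ i : Fin n, pderiv j (X i ^ p ^ e : MvPolynomial (Fin n) k) = 0 := fun i => by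
    rw [pderiv_pow, Nat.cast_pow, CharP.cast_eq_zero (MvPolynomial (Fin n) k) p, zero_pow he,
      zero_mul, zero_mul]
  simp only [frobForm, map_sum]
  refine Finset.sum_congr rfl fun i _ => ?_
  rw [Finset.sum_eq_single j]
  · simp [hpow]
  · intro b _ hb
    simp [hpow, pderiv_X_of_ne hb]
  · simp

theorem mem_singularLocus_frobForm {p : ℕ} [CharP k p] {e : ℕ} (he : e ≠ 0)
    {A : Matrix (Fin n) (Fin n) k} {v : Fin n → k} :
    v ∈ singularLocus (frobForm (p ^ e) A) ↔ A.vecMul (fun i => v i ^ p ^ e) = 0 := by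
  have hd : ∀ j, eval v (pderiv j (frobForm (p ^ e) A)) =
      A.vecMul (fun i => v i ^ p ^ e) j := fun j => by
    simp [pderiv_frobForm he, Matrix.vecMul, dotProduct, mul_comm]
  have hf : eval v (frobForm (p ^ e) A) = A.vecMul (fun i => v i ^ p ^ e) ⬝ᵥ v := by
    rw [← Matrix.dotProduct_mulVec]
    simp only [frobForm, map_sum, map_mul, map_pow, eval_C, eval_X, dotProduct, Matrix.mulVec,
      Finset.mul_sum]
    simp only [mul_assoc, mul_left_comm]
  constructor
  · rintro ⟨-, h⟩
    funext j
    rw [← hd, h, Pi.zero_apply]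
  · intro h
    exact ⟨by rw [hf, h, zero_dotProduct], fun j => by rw [hd, h, Pi.zero_apply]⟩

/-- The singular locus of a Frobenius form is the preimage of a linear space under the bijection
`(vᵢ) ↦ (vᵢ ^ q)`. -/
theorem hasIsolatedSingularity_frobForm_iff {p : ℕ} [Fact p.Prime] [CharP k p] [IsAlgClosed k]
    {e : ℕ} (he : e ≠ 0) {A : Matrix (Fin n) (Fin n) k} :
    HasIsolatedSingularity (frobForm (p ^ e) A) ↔ IsUnit A.det := by
  have hq : p ^ e ≠ 0 := pow_ne_zero _ (Fact.out : p.Prime).ne_zero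
  rw [isUnit_iff_ne_zero]
  constructor
  · rintro ⟨-, h, h0, H⟩ hdet
    obtain ⟨w, hw0, hw⟩ := Matrix.exists_vecMul_eq_zero_iff.2 hdet
    -- The `q`-th root of a left null vector spans a line in the singular locus.
    let v : Fin n → k := fun i => (frob k p e).symm (w i)
    have hv : ∀ i, v i ^ p ^ e = w i := fun i => by
      have := (frob k p e).apply_symm_apply (w i)
      rwa [coe_iterateFrobeniusEquiv, iterateFrobenius_def] at this
    have hv0 : v ≠ 0 := by
      rintro hv0
      refine hw0 (funext fun i => ?_)
      rw [← hv i, hv0, Pi.zero_apply, zero_pow hq]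
    let P : Polynomial k := aeval (fun i => Polynomial.C (v i) * Polynomial.X) h
    have hP : ∀ t, P.eval t = eval (fun i => v i * t) h := fun t => by
      have : (Polynomial.evalRingHom t).comp (aeval (R := k) fun i =>
          Polynomial.C (v i) * Polynomial.X : MvPolynomial (Fin n) k →ₐ[k] Polynomial k).toRingHom
          = eval (fun i => v i * t) := by
        ext <;> simp
      exact congr($this h)
    have hP0 : P ≠ 0 := by
      intro hP0
      have := hP 0
      rw [hP0, Polynomial.eval_zero] at this
      simp only [mul_zero] at this
      exact h0 this.symm
    obtain ⟨t, ht⟩ : ∃ t, (Polynomial.X * P).eval t ≠ 0 := by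
      by_contra! hcon
      exact mul_ne_zero Polynomial.X_ne_zero hP0 (Polynomial.funext fun t => by simp [hcon t])
    rw [Polynomial.eval_mul, Polynomial.eval_X] at ht
    have hsing : (fun i => v i * t) ∈ singularLocus (frobForm (p ^ e) A) := by
      rw [mem_singularLocus_frobForm he]
      have : (fun i => (v i * t) ^ p ^ e) = t ^ p ^ e • w := by
        funext i
        rw [mul_pow, hv, Pi.smul_apply, smul_eq_mul, mul_comm]
      rw [this, Matrix.smul_vecMul, hw, smul_zero]
    have hz := H _ hsing (by rw [← hP]; exact right_ne_zero_of_mul ht)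
    exact hv0 (funext fun i =>
      (mul_eq_zero.1 (congr_fun hz i)).resolve_right (left_ne_zero_of_mul ht))
  · intro hdet
    have hroot : ∀ v ∈ singularLocus (frobForm (p ^ e) A), v = 0 := fun v hv =>
      funext fun i => pow_eq_zero_iff hq |>.1 <|
        congr_fun (Matrix.eq_zero_of_vecMul_eq_zero hdet ((mem_singularLocus_frobForm he).1 hv)) i
    refine ⟨(mem_singularLocus_frobForm he).2 ?_, 1, by simp, fun v hv _ => hroot v hv⟩
    have : (fun i => (0 : Fin n → k) i ^ p ^ e) = 0 := funext fun i => zero_pow hq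
    rw [this, Matrix.zero_vecMul]

theorem rank_eq_iff_isUnit_det {A : Matrix (Fin n) (Fin n) k} : A.rank = n ↔ IsUnit A.det := by
  constructor
  · intro h
    rw [← Matrix.isUnit_iff_isUnit_det, ← Matrix.mulVec_surjective_iff_isUnit]
    have : LinearMap.range A.mulVecLin = ⊤ :=
      Submodule.eq_top_of_finrank_eq (by rw [Module.finrank_fin_fun]; exact h)
    exact LinearMap.range_eq_top.1 this
  · intro h
    simpa using Matrix.rank_of_isUnit A ((Matrix.isUnit_iff_isUnit_det A).2 h)

/-! ### The diagonal form is extremal -/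

theorem diagForm_eq_frobForm (q : ℕ) :
    diagForm k n (q + 1) = frobForm q (1 : Matrix (Fin n) (Fin n) k) := by
  refine Finset.sum_congr rfl fun i _ => ?_
  rw [Finset.sum_eq_single i (fun j _ hj => by simp [Matrix.one_apply_ne hj.symm]) (by simp)]
  simp [pow_succ]

theorem not_dvd_choose_pow_sub_one {p : ℕ} (hp : p.Prime) (b : ℕ) {i : ℕ} (hi : i < p ^ b) :
    ¬ p ∣ (p ^ b - 1).choose i := by
  induction i with
  | zero => simpa using hp.one_lt.ne'
  | succ i ih =>
    intro h
    have h1 : p ∣ (p ^ b).choose (i + 1) := hp.dvd_choose_pow (by simp) (by lia)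
    rw [← Nat.sub_add_cancel (show 1 ≤ p ^ b by lia), Nat.choose_succ_succ] at h1
    exact ih (by lia) ((Nat.dvd_add_left h).1 h1)

/-- Membership in `𝔪^[p ^ e]` bounds the `F`-pure threshold by `1 / p ^ e`. -/
theorem pow_mem_frobPower {p : ℕ} [Fact p.Prime] [CharP k p] {e a N : ℕ}
    {f : MvPolynomial (Fin n) k} (hf : f ∈ frobPower k n (p ^ e)) (h : p ^ a ≤ N * p ^ e) :
    f ^ N ∈ frobPower k n (p ^ a) := by
  rw [← pow_char_pow_mem_frobPower_iff e, ← pow_mul, ← Nat.sub_add_cancel h, pow_add,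
    mul_comm (p ^ e)]
  exact Ideal.mul_mem_left _ _ ((pow_char_pow_mem_frobPower_iff a).2 hf)

theorem frobForm_mem_frobPower (q : ℕ) (A : Matrix (Fin n) (Fin n) k) :
    frobForm q A ∈ frobPower k n q :=
  Ideal.sum_mem _ fun i _ => Ideal.sum_mem _ fun _ _ => Ideal.mul_mem_right _ _ <|
    Ideal.mul_mem_left _ _ (Ideal.subset_span ⟨i, rfl⟩)

/-- The binomial theorem, read off coefficientwise. -/
theorem coeff_add_pow_X {i j : Fin n} (hij : i ≠ j) {d : ℕ} (hd : d ≠ 0) {M m : ℕ} (hm : m ≤ M) :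
    coeff (Finsupp.single i (d * m) + Finsupp.single j (d * (M - m)))
      ((X i ^ d + X j ^ d : MvPolynomial (Fin n) k) ^ M) = (M.choose m : k) := by
  classical
  have hterm : ∀ a, ((X i ^ d) ^ a * (X j ^ d) ^ (M - a) * ((M.choose a : ℕ) :
      MvPolynomial (Fin n) k)) =
        monomial (Finsupp.single i (d * a) + Finsupp.single j (d * (M - a)))
          (M.choose a : k) := fun a => by
    rw [← pow_mul, ← pow_mul, X_pow_eq_monomial, X_pow_eq_monomial, monomial_mul, ← map_natCast C,
      mul_comm, C_mul_monomial]
    simp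
  simp only [add_pow, hterm, coeff_sum, coeff_monomial]
  rw [Finset.sum_eq_single m, if_pos rfl]
  · intro a _ ha
    refine if_neg fun h => ha ?_
    have h1 := DFunLike.congr_fun h i
    simp only [Finsupp.add_apply, Finsupp.single_eq_same, Finsupp.single_eq_of_ne hij,
      add_zero] at h1
    exact Nat.eq_of_mul_eq_mul_left (Nat.pos_of_ne_zero hd) h1
  · intro h
    exact absurd (Finset.mem_range.2 (by lia)) h

/-- The quotients `(p ^ b - 1) / p ^ (b + e)` tend to `1 / p ^ e`, which bounds the `F`-pure
threshold of the diagonal form from below. -/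
theorem diagForm_pow_notMem_frobPower {p : ℕ} [Fact p.Prime] [CharP k p] {e : ℕ} (he : e ≠ 0)
    (hn : 2 ≤ n) (b : ℕ) :
    diagForm k n (p ^ e + 1) ^ (p ^ b - 1) ∉ frobPower k n (p ^ (b + e)) := by
  have hp : p.Prime := Fact.out
  have hq : 1 < p ^ e := Nat.one_lt_pow he hp.one_lt
  have hb : 0 < p ^ b := pow_pos hp.pos b
  let i₀ : Fin n := ⟨0, by lia⟩
  let i₁ : Fin n := ⟨1, by lia⟩
  have hne : i₀ ≠ i₁ := by simp [i₀, i₁]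
  -- Setting all variables but two to zero reduces to two variables.
  let φ : MvPolynomial (Fin n) k →ₐ[k] MvPolynomial (Fin n) k :=
    aeval fun i => if i = i₀ ∨ i = i₁ then X i else 0
  have hφ : φ (diagForm k n (p ^ e + 1)) = X i₀ ^ (p ^ e + 1) + X i₁ ^ (p ^ e + 1) := by
    simp only [diagForm, map_sum, map_pow, φ, aeval_X]
    rw [← Finset.sum_subset (Finset.subset_univ {i₀, i₁}), Finset.sum_pair hne]
    · simp
    · intro i _ hi
      rw [if_neg (by simpa using hi), zero_pow (by simp)]
  intro h
  have hmem : φ (diagForm k n (p ^ e + 1) ^ (p ^ b - 1)) ∈ frobPower k n (p ^ (b + e)) := by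
    have : Ideal.map φ (frobPower k n (p ^ (b + e))) ≤ frobPower k n (p ^ (b + e)) := by
      rw [frobPower, Ideal.map_span, Ideal.span_le]
      rintro _ ⟨_, ⟨i, rfl⟩, rfl⟩
      simp only [map_pow, φ, aeval_X]
      split_ifs
      · exact Ideal.subset_span ⟨i, rfl⟩
      · rw [zero_pow (pow_ne_zero _ hp.ne_zero)]
        exact zero_mem _
    exact this (Ideal.mem_map_of_mem φ h)
  rw [map_pow, hφ, mem_frobPower_iff] at hmem
  -- The middle binomial coefficient is prime to `p`, and both exponents are small enough.
  have hm : (p ^ b - 1) / 2 ≤ p ^ b - 1 := Nat.div_le_self _ _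
  obtain ⟨i, hi⟩ := hmem _ (mem_support_iff.2 ((coeff_add_pow_X (k := k) hne
    (Nat.succ_ne_zero (p ^ e)) hm).trans_ne ((CharP.cast_eq_zero_iff k p _).not.2
      (not_dvd_choose_pow_sub_one hp b (by lia)))))
  have hsmall : ∀ m, 2 * m ≤ p ^ b → (p ^ e + 1) * m < p ^ (b + e) := fun m h => by
    rw [pow_add]
    rcases Nat.eq_zero_or_pos m with rfl | hm0
    · simpa using ⟨pow_pos hp.pos _, pow_pos hp.pos _⟩
    · nlinarith
  have h0 := hsmall ((p ^ b - 1) / 2) (by lia)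
  have h1 := hsmall (p ^ b - 1 - (p ^ b - 1) / 2) (by lia)
  simp only [Finsupp.add_apply, Finsupp.single_apply] at hi
  have hpos : 0 < p ^ (b + e) := pow_pos hp.pos _
  split_ifs at hi with h2 h3 h3
  · exact hne (h2.trans h3.symm)
  · exact absurd hi (by simpa using h0)
  · exact absurd hi (by simpa using h1)
  · lia

/-- A double factor divides all partial derivatives, which are powers of distinct variables. -/
theorem squarefree_diagForm {p : ℕ} [Fact p.Prime] [CharP k p] {e : ℕ} (he : e ≠ 0)
    (hn : 2 ≤ n) : Squarefree (diagForm k n (p ^ e + 1)) := by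
  rintro x ⟨y, hy⟩
  have hx : ∀ j, x ∣ X j ^ p ^ e := fun j => by
    have h : pderiv j (diagForm k n (p ^ e + 1)) = X j ^ p ^ e := by
      rw [diagForm_eq_frobForm, pderiv_frobForm he,
        Finset.sum_eq_single j (fun i _ hi => by simp [Matrix.one_apply_ne hi]) (by simp)]
      simp
    rw [← h, hy]
    simp only [pderiv_mul]
    exact ⟨pderiv j x * y + pderiv j x * y + x * pderiv j y, by ring⟩
  have hrel : IsRelPrime (X ⟨0, by lia⟩ : MvPolynomial (Fin n) k) (X ⟨1, by lia⟩) := by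
    rw [X_prime.irreducible.isRelPrime_iff_not_dvd, X_dvd_X]
    simp
  exact hrel.pow (hx _) (hx _)

theorem isExtremal_diagForm {p : ℕ} [Fact p.Prime] [CharP k p] {e : ℕ} (he : e ≠ 0)
    (hn : 2 ≤ n) : IsExtremal p (p ^ e + 1) (diagForm k n (p ^ e + 1)) := by
  have hp : p.Prime := Fact.out
  have hp0 : (0 : ℝ) < p := by exact_mod_cast hp.pos
  have hq : 1 < p ^ e := Nat.one_lt_pow he hp.one_lt
  refine ⟨by lia, IsHomogeneous.sum _ _ _ fun i _ => isHomogeneous_X_pow i _,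
    squarefree_diagForm he hn, ?_⟩
  have hle : ∀ t ∈ {t : ℝ | ∃ N a : ℕ, diagForm k n (p ^ e + 1) ^ N ∉ frobPower k n (p ^ a) ∧
      t = (N : ℝ) / (p : ℝ) ^ a}, t ≤ 1 / (p : ℝ) ^ e := by
    rintro _ ⟨N, a, h, rfl⟩
    have : N * p ^ e < p ^ a := by
      by_contra! hcon
      exact h (pow_mem_frobPower (by
        rw [diagForm_eq_frobForm]
        exact frobForm_mem_frobPower _ _) hcon)
    rw [div_le_div_iff₀ (by positivity) (by positivity), one_mul]
    exact_mod_cast this.le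
  rw [show ((p ^ e + 1 : ℕ) : ℝ) - 1 = (p : ℝ) ^ e by push_cast; ring]
  refine le_antisymm (csSup_le ⟨_, _, _, diagForm_pow_notMem_frobPower he hn 0, rfl⟩ hle) ?_
  · have hlim : Filter.Tendsto (fun b : ℕ => (1 - (1 / (p : ℝ)) ^ b) / (p : ℝ) ^ e) Filter.atTop
        (nhds ((1 - 0) / (p : ℝ) ^ e)) := by
      refine ((tendsto_pow_atTop_nhds_zero_of_lt_one (by positivity) ?_).const_sub 1).div_const _
      rw [div_lt_one hp0]
      exact_mod_cast hp.one_lt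
    rw [sub_zero] at hlim
    refine le_of_tendsto' hlim fun b => le_csSup ⟨_, hle⟩ ⟨p ^ b - 1, b + e,
      diagForm_pow_notMem_frobPower he hn b, ?_⟩
    rw [Nat.cast_sub (Nat.one_le_pow _ _ hp.pos), pow_add]
    push_cast
    field_simp
    rw [sub_mul, one_mul, ← mul_pow, one_div_mul_cancel hp0.ne', one_pow]

theorem embDim_diagForm {p : ℕ} [Fact p.Prime] [CharP k p] [PerfectRing k p] {e : ℕ}
    (he : e ≠ 0) : embDim (diagForm k n (p ^ e + 1)) = n := by
  have h := embDim_frobForm_add_finrank_radical (p := p) he (1 : Matrix (Fin n) (Fin n) k)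
  have hr : radical (frob k p e) (1 : Matrix (Fin n) (Fin n) k) = ⊥ := by
    rw [eq_bot_iff]
    refine inf_le_left.trans ?_
    rw [Matrix.mulVecLin_one, LinearMap.ker_id]
  rwa [hr, finrank_bot, add_zero, ← diagForm_eq_frobForm] at h

/-! ### Classification of extremal singularities -/

theorem exists_finset_isoClass [IsAlgClosed k] (p : ℕ) [Fact p.Prime] [CharP k p] (N n d : ℕ) :
    ∃ S : Finset (Quotient (isoSetoid k N)), S.card ≤ Nat.fib (n + 1) ∧
      ∀ f : MvPolynomial (Fin N) k, IsExtremal p d f → embDim f = n → isoClass f ∈ S := by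
  classical
  by_cases hd : ∃ e, 1 ≤ e ∧ d = p ^ e + 1
  · obtain ⟨e, he, rfl⟩ := hd
    obtain ⟨S, hS, hrep⟩ := exists_representatives_radical (σ := frob k p e)
      (fun m A hA => congruent_one_of_isUnit_det (by lia) hA) N n
    refine ⟨S.image fun B => isoClass (frobForm (p ^ e) B), Finset.card_image_le.trans hS, ?_⟩
    intro f hf hn
    obtain ⟨e', -, hd, A, rfl⟩ := hf.exists_eq_frobForm
    obtain rfl := Nat.pow_right_injective (Fact.out : p.Prime).two_le (Nat.add_right_cancel hd)
    have h := embDim_frobForm_add_finrank_radical (p := p) (e := e) (by lia) A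
    obtain ⟨B, hB, hBA⟩ := hrep A (by lia)
    exact Finset.mem_image.2 ⟨B, hB, hBA.isoClass_eq⟩
  · refine ⟨∅, by simp, fun f hf _ => absurd ?_ hd⟩
    obtain ⟨e, he, hd, -⟩ := hf.exists_eq_frobForm
    exact ⟨e, he, hd⟩

theorem IsExtremal.embDim_le {p d : ℕ} [Fact p.Prime] [CharP k p] [IsAlgClosed k]
    {f : MvPolynomial (Fin n) k} (hf : IsExtremal p d f) : embDim f ≤ n := by
  obtain ⟨e, he, -, A, rfl⟩ := hf.exists_eq_frobForm
  have h := embDim_frobForm_add_finrank_radical (p := p) (e := e) (by lia) A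
  lia

theorem IsExtremal.hasIsolatedSingularity_iff_isFullRank {p d : ℕ} [Fact p.Prime] [CharP k p]
    [IsAlgClosed k] {f : MvPolynomial (Fin n) k} (hf : IsExtremal p d f) :
    HasIsolatedSingularity f ↔ IsFullRank p f := by
  constructor
  · obtain ⟨e, he, -, A, rfl⟩ := hf.exists_eq_frobForm
    exact fun h => ⟨e, A, he, rfl, rank_eq_iff_isUnit_det.2
      ((hasIsolatedSingularity_frobForm_iff (by lia)).1 h)⟩
  · rintro ⟨e, A, he, rfl, hA⟩
    exact (hasIsolatedSingularity_frobForm_iff (by lia)).2 (rank_eq_iff_isUnit_det.1 hA)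

theorem IsExtremal.isoClass_eq_diagForm {p e : ℕ} [Fact p.Prime] [CharP k p] [IsAlgClosed k]
    {f : MvPolynomial (Fin n) k} (hf : IsExtremal p (p ^ e + 1) f)
    (h : HasIsolatedSingularity f) : isoClass f = isoClass (diagForm k n (p ^ e + 1)) := by
  obtain ⟨e', he, hd, A, rfl⟩ := hf.exists_eq_frobForm
  obtain rfl := Nat.pow_right_injective (Fact.out : p.Prime).two_le (Nat.add_right_cancel hd)
  have hA := (hasIsolatedSingularity_frobForm_iff (by lia)).1 h
  rw [diagForm_eq_frobForm]
  exact (congruent_one_of_isUnit_det (by lia) hA).isoClass_eq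

theorem hasIsolatedSingularity_of_isoClass_eq_diagForm {p e : ℕ} [Fact p.Prime] [CharP k p]
    [IsAlgClosed k] (he : e ≠ 0) {f : MvPolynomial (Fin n) k}
    (h : isoClass f = isoClass (diagForm k n (p ^ e + 1))) : HasIsolatedSingularity f := by
  obtain ⟨g, rfl⟩ : ∃ g : Matrix.GeneralLinearGroup (Fin n) k,
      linSubst g.val (diagForm k n (p ^ e + 1)) = f := Quotient.exact h.symm
  rw [diagForm_eq_frobForm, linSubst_frobForm, hasIsolatedSingularity_frobForm_iff he,
    Matrix.mul_one, Matrix.det_mul, Matrix.det_transpose]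
  have hg : IsUnit g.val.det := (Matrix.isUnit_iff_isUnit_det _).1 g.isUnit
  refine IsUnit.mul ?_ hg
  have : (g.val.map (frob k p e)).det = frob k p e g.val.det :=
    ((frob k p e : k →+* k).map_det g.val).symm
  rw [this]
  exact hg.map _

end FrobThreshold

end

/-- Extremal singularities over an algebraically closed field of characteristic `p`, up to
linear change of coordinates. In the first two parts the form may be written in any number `N`
of variables. The Fibonacci sequence is normalized by `F₀ = F₁ = 1`, so `Fₙ = Nat.fib (n + 1)`. -/
theorem theorem1p2 {k : Type*} [Field k] [IsAlgClosed k] (p : ℕ) [Fact p.Prime] [CharP k p] :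
    -- fixed degree and embedding dimension: finitely many classes, at most `Fₙ`
    (∀ N n d : ℕ,
      (FrobThreshold.isoClass '' {f : MvPolynomial (Fin N) k |
          FrobThreshold.IsExtremal p d f ∧ FrobThreshold.embDim f = n}).Finite ∧
      (FrobThreshold.isoClass '' {f : MvPolynomial (Fin N) k |
          FrobThreshold.IsExtremal p d f ∧ FrobThreshold.embDim f = n}).ncard
        ≤ Nat.fib (n + 1)) ∧
    -- bounded degree and number of variables: finitely many classes
    (∀ N D : ℕ,
      (FrobThreshold.isoClass '' {f : MvPolynomial (Fin N) k |
          ∃ d ≤ D, FrobThreshold.IsExtremal p d f}).Finite) ∧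
    -- isolated singularity, full rank, and diagonalizability are equivalent
    (∀ (n d : ℕ) (f : MvPolynomial (Fin n) k), FrobThreshold.IsExtremal p d f →
      (FrobThreshold.HasIsolatedSingularity f ↔ FrobThreshold.IsFullRank p f) ∧
      (FrobThreshold.HasIsolatedSingularity f ↔
        ∃ e : ℕ, 1 ≤ e ∧ d = p ^ e + 1 ∧
          FrobThreshold.isoClass f =
            FrobThreshold.isoClass (FrobThreshold.diagForm k n (p ^ e + 1)))) ∧
    -- exactly one class has an isolated singularity: that of the diagonal form
    (∀ n e : ℕ, 2 ≤ n → 1 ≤ e →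
      FrobThreshold.isoClass '' {f : MvPolynomial (Fin n) k |
          FrobThreshold.IsExtremal p (p ^ e + 1) f ∧ FrobThreshold.embDim f = n ∧
            FrobThreshold.HasIsolatedSingularity f} =
        {FrobThreshold.isoClass (FrobThreshold.diagForm k n (p ^ e + 1))}) := by
  classical
  have key := fun N n d => FrobThreshold.exists_finset_isoClass (k := k) p N n d
  refine ⟨fun N n d => ?_, fun N D => ?_, fun n d f hf => ⟨?_, ?_⟩, fun n e hn he => ?_⟩
  · obtain ⟨S, hS, hmem⟩ := key N n d
    have hsub : FrobThreshold.isoClass '' {f : MvPolynomial (Fin N) k |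
        FrobThreshold.IsExtremal p d f ∧ FrobThreshold.embDim f = n} ⊆ S := by
      rintro _ ⟨f, ⟨hf, hn⟩, rfl⟩
      exact hmem f hf hn
    refine ⟨S.finite_toSet.subset hsub, (Set.ncard_le_ncard hsub S.finite_toSet).trans ?_⟩
    rwa [Set.ncard_coe_finset]
  · choose S _ hmem using key
    refine ((Finset.range (D + 1)).biUnion fun d => (Finset.range (N + 1)).biUnion fun n =>
      S N n d).finite_toSet.subset ?_
    rintro _ ⟨f, ⟨d, hd, hf⟩, rfl⟩
    simp only [Finset.coe_biUnion, Set.mem_iUnion, Finset.mem_coe, Finset.mem_range]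
    exact ⟨d, by lia, FrobThreshold.embDim f, by have := hf.embDim_le; lia, hmem N _ d f hf rfl⟩
  · exact hf.hasIsolatedSingularity_iff_isFullRank
  · constructor
    · intro h
      obtain ⟨e, he, rfl, -⟩ := hf.exists_eq_frobForm
      exact ⟨e, he, rfl, hf.isoClass_eq_diagForm h⟩
    · rintro ⟨e, he, -, h⟩
      exact FrobThreshold.hasIsolatedSingularity_of_isoClass_eq_diagForm (by lia) h
  · ext c
    constructor
    · rintro ⟨f, ⟨hf, -, h⟩, rfl⟩
      exact hf.isoClass_eq_diagForm h
    · rintro rfl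
      exact ⟨_, ⟨FrobThreshold.isExtremal_diagForm (by lia) hn,
        FrobThreshold.embDim_diagForm (by lia),
        FrobThreshold.hasIsolatedSingularity_of_isoClass_eq_diagForm (by lia) rfl⟩, rfl⟩
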